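/- Let $p,q\ge 0$ and $n=p+q$. Write $\mathrm{Sp}(p,q)=\{g\in \mathrm{SL}_n(\mathbb H): \bar g^{t}I_{p,q}\,g=I_{p,q}\}$ and $\mathfrak{sp}(p,q)=\{Z\in \mathfrak{sl}_n(\mathbb H): \bar Z^{t}I_{p,q}+I_{p,q}Z=0\}$, where $I_{p,q}=\mathrm{diag}(I_p,-I_q)$, and $\mathrm{SL}_n(\mathbb H)$, $\mathfrak{sl}_n(\mathbb H)$ are defined by reduced norm $1$ and reduced trace $0$; write $\mathrm{SO}^*(2m)=\{g\in \mathrm{SL}_m(\mathbb H): \bar g^{t}(\mathbf j I_m)g=\mathbf j I_m\}$. Let $X\in\mathfrak{sp}(p,q)$ be a nonzero nilpotent element and let $\{X,H,Y\}\subset\mathfrak{sp}(p,q)$ be an $\mathfrak{sl}_2(\mathbb R)$-triple, that is, $[H,X]=2X$, $[H,Y]=-2Y$, $[X,Y]=H$. Let $V=\mathbb H^n$ be the right $\mathbb H$-vector space of column vectors, with the form $\langle x,y\rangle=\bar x^{t}I_{p,q}\,y$. Let $\mathbb N_{\mathbf d}$ be the set of the real dimensions of the irreducible $\mathrm{Span}_{\mathbb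 R}\{X,H,Y\}$-submodules of $V$, and let $\mathbb E_{\mathbf d}$ and $\mathbb O_{\mathbf d}$ be the sets of its even and of its odd elements. For $d\in\mathbb N_{\mathbf d}$ let $M(d-1)$ be the sum of all irreducible submodules of real dimension $d$, let $L(d-1)=\{v\in M(d-1): Yv=0\}$, which is an $\mathbb H$-subspace of $V$, let $t_d=\dim_{\mathbb H}L(d-1)$, and let $(v,u)_d=\langle v,X^{d-1}u\rangle$ for $v,u\in L(d-1)$. For every $\theta\in\mathbb O_{\mathbf d}$ the form $(\cdot,\cdot)_\theta$ is a non-degenerate Hermitian form on $L(\theta-1)$, so that it has a signature $(p_\theta,q_\theta)$: there is an orthogonal $\mathbb H$-basis of $L(\theta-1)$ with $p_\theta$ vectors $v$ satisfying $(v,v)_\theta=1$ and $q_\theta$ vectors satisfying $(v,v)_\theta=-1$. Moreover, there is an isomorphism of topological groups (equivalently, of Lie groups) $$\mathcal Z_{\mathrm{Sp}(p,q)}(X,H,Y)\;\cong\;\prod_{\eta\in\mathbb E_{\mathbf d}}\mathrm{SO}^*(2t_\eta)\;\times\;\prod_{\theta\in\mathbb O_{\mathbf d}}\mathrm{Sp}(p_\theta,q_\theta),$$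 where $\mathcal Z_{\mathrm{Sp}(p,q)}(X,H,Y)$ is the group of all $g\in\mathrm{Sp}(p,q)$ with $gZg^{-1}=Z$ for $Z\in\{X,H,Y\}$. -/

import Mathlib

open scoped Quaternion Matrix

attribute [local instance] LieRing.ofAssociativeRing

namespace QuatForm

/-- The standard embedding `a + b i + c j + d k ↦ !![a + b i, c + d i; -c + d i, a - b i]` of the
real quaternions into the complex `2 × 2` matrices. -/
noncomputable def quatToComplex : ℍ[ℝ] →ₐ[ℝ] Matrix (Fin 2) (Fin 2) ℂ where
  toFun q := !![⟨q.re, q.imI⟩, ⟨q.imJ, q.imK⟩; ⟨-q.imJ, q.imK⟩, ⟨q.re, -q.imI⟩]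
  map_one' := by
    ext i j
    fin_cases i <;> fin_cases j <;> simp [Complex.ext_iff]
  map_mul' a b := by
    ext i j
    fin_cases i <;> fin_cases j <;> simp [Complex.ext_iff, Matrix.mul_apply] <;>
      constructor <;> ring
  map_zero' := by
    ext i j
    fin_cases i <;> fin_cases j <;> simp [Complex.ext_iff]
  map_add' a b := by
    ext i j
    fin_cases i <;> fin_cases j <;> simp [Complex.ext_iff, add_comm]
  commutes' r := by
    ext i j
    fin_cases i <;> fin_cases j <;> simp [Complex.ext_iff, Matrix.algebraMap_matrix_apply]

section groups

variable {n : Type} [Fintype n] [DecidableEq n]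

/-- The embedding of the quaternionic `n × n` matrices into the complex `2n × 2n` matrices. -/
noncomputable def toComplexMatrix : Matrix n n ℍ[ℝ] →ₐ[ℝ] Matrix (n × Fin 2) (n × Fin 2) ℂ :=
  (Matrix.compAlgEquiv n (Fin 2) ℂ ℝ).toAlgHom.comp quatToComplex.mapMatrix

/-- The reduced norm of `M_n(ℍ)`. -/
noncomputable def reducedNorm (A : Matrix n n ℍ[ℝ]) : ℂ := (toComplexMatrix A).det

/-- The reduced trace of `M_n(ℍ)`. -/
noncomputable def reducedTrace (A : Matrix n n ℍ[ℝ]) : ℂ := (toComplexMatrix A).trace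

/-- For a quaternionic matrix `J`, the group of all `g ∈ SL_n(ℍ)` (reduced norm one) with
`ḡᵗ J g = J`. -/
noncomputable def formGroup (J : Matrix n n ℍ[ℝ]) : Subgroup (Matrix n n ℍ[ℝ])ˣ where
  carrier := {g | reducedNorm (g : Matrix n n ℍ[ℝ]) = 1 ∧
    (g : Matrix n n ℍ[ℝ])ᴴ * J * (g : Matrix n n ℍ[ℝ]) = J}
  one_mem' := by simp [reducedNorm]
  mul_mem' := by
    rintro a b ⟨ha, ha'⟩ ⟨hb, hb'⟩
    refine ⟨?_, ?_⟩
    · simp only [reducedNorm] at *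
      simp [ha, hb]
    · calc ((a * b : (Matrix n n ℍ[ℝ])ˣ) : Matrix n n ℍ[ℝ])ᴴ * J *
            ((a * b : (Matrix n n ℍ[ℝ])ˣ) : Matrix n n ℍ[ℝ])
          = (b : Matrix n n ℍ[ℝ])ᴴ * ((a : Matrix n n ℍ[ℝ])ᴴ * J * a) * b := by
            simp [Matrix.conjTranspose_mul, Matrix.mul_assoc]
        _ = J := by rw [ha', hb']
  inv_mem' := by
    rintro a ⟨ha, ha'⟩
    have h1 : (a : Matrix n n ℍ[ℝ]) * ((a⁻¹ : (Matrix n n ℍ[ℝ])ˣ) : Matrix n n ℍ[ℝ]) = 1 :=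
      Units.mul_inv a
    refine ⟨?_, ?_⟩
    · have h2 := congrArg reducedNorm h1
      simp only [reducedNorm, map_mul, map_one, Matrix.det_mul, Matrix.det_one] at *
      simpa [ha] using h2
    · have h3 : (((a⁻¹ : (Matrix n n ℍ[ℝ])ˣ) : Matrix n n ℍ[ℝ]))ᴴ * (a : Matrix n n ℍ[ℝ])ᴴ = 1 := by
        rw [← Matrix.conjTranspose_mul, h1, Matrix.conjTranspose_one]
      set b : Matrix n n ℍ[ℝ] := ((a⁻¹ : (Matrix n n ℍ[ℝ])ˣ) : Matrix n n ℍ[ℝ]) with hb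
      calc bᴴ * J * b = bᴴ * ((a : Matrix n n ℍ[ℝ])ᴴ * J * a) * b := by rw [ha']
        _ = (bᴴ * (a : Matrix n n ℍ[ℝ])ᴴ) * J * ((a : Matrix n n ℍ[ℝ]) * b) := by
            simp only [Matrix.mul_assoc]
        _ = J := by rw [h1, h3, Matrix.one_mul, Matrix.mul_one]

/-- For a quaternionic matrix `J`, the real Lie algebra of all `Z ∈ sl_n(ℍ)` (reduced trace zero)
with `Z̄ᵗ J + J Z = 0`. -/
noncomputable def formLie (J : Matrix n n ℍ[ℝ]) : LieSubalgebra ℝ (Matrix n n ℍ[ℝ]) where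
  carrier := {Z | reducedTrace Z = 0 ∧ Zᴴ * J + J * Z = 0}
  zero_mem' := by simp [reducedTrace]
  add_mem' := by
    rintro a b ⟨ha, ha'⟩ ⟨hb, hb'⟩
    refine ⟨?_, ?_⟩
    · simp only [reducedTrace] at *
      simp [ha, hb]
    · calc (a + b)ᴴ * J + J * (a + b) = (aᴴ * J + J * a) + (bᴴ * J + J * b) := by
            rw [Matrix.conjTranspose_add, add_mul, mul_add]; abel
        _ = 0 := by rw [ha', hb', add_zero]
  smul_mem' := by
    rintro r a ⟨ha, ha'⟩
    refine ⟨?_, ?_⟩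
    · simp only [reducedTrace] at *
      simp [ha]
    · calc (r • a)ᴴ * J + J * (r • a) = r • (aᴴ * J + J * a) := by
            have h : (r • a)ᴴ = r • aᴴ := 
              Matrix.ext fun i j => Quaternion.star_smul r (a j i)
            rw [h, smul_add]; simp
        _ = 0 := by rw [ha', smul_zero]
  lie_mem' := by
    rintro a b ⟨ha, ha'⟩ ⟨hb, hb'⟩
    refine ⟨?_, ?_⟩
    · simp only [reducedTrace] at *
      rw [Ring.lie_def, map_sub, map_mul, map_mul, Matrix.trace_sub, Matrix.trace_mul_comm,
        sub_self]
    · have h1 : aᴴ * J = -(J * a) := eq_neg_of_add_eq_zero_left ha'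
      have h2 : bᴴ * J = -(J * b) := eq_neg_of_add_eq_zero_left hb'
      rw [Ring.lie_def, Matrix.conjTranspose_sub, Matrix.conjTranspose_mul,
        Matrix.conjTranspose_mul, sub_mul, mul_assoc, mul_assoc, h1, h2, mul_neg, mul_neg,
        ← mul_assoc, ← mul_assoc, h1, h2, mul_sub, neg_mul, neg_mul, mul_assoc, mul_assoc]
      abel

/-- The centralizer `{h ∈ K | Ad(h) Z = Z for all Z ∈ S}` of a set of matrices `S` in a group `K`
of invertible matrices, where `Ad(h) Z = h Z h⁻¹`. -/
noncomputable def adCentralizer (K : Subgroup (Matrix n n ℍ[ℝ])ˣ) (S : Set (Matrix n n ℍ[ℝ])) :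
    Subgroup (Matrix n n ℍ[ℝ])ˣ where
  carrier := {h | h ∈ K ∧ ∀ Z ∈ S,
    (h : Matrix n n ℍ[ℝ]) * Z * ((h⁻¹ : (Matrix n n ℍ[ℝ])ˣ) : Matrix n n ℍ[ℝ]) = Z}
  one_mem' := ⟨K.one_mem, by simp⟩
  mul_mem' := by
    rintro a b ⟨ha, ha'⟩ ⟨hb, hb'⟩
    refine ⟨K.mul_mem ha hb, fun Z hZ => ?_⟩
    have h1 := ha' Z hZ
    rw [Units.mul_inv_eq_iff_eq_mul] at h1 ⊢
    have h2 := hb' Z hZ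
    rw [Units.mul_inv_eq_iff_eq_mul] at h2
    rw [Units.val_mul, mul_assoc, h2, ← mul_assoc, h1, mul_assoc]
  inv_mem' := by
    rintro a ⟨ha, ha'⟩
    refine ⟨K.inv_mem ha, fun Z hZ => ?_⟩
    have h1 := ha' Z hZ
    rw [Units.mul_inv_eq_iff_eq_mul] at h1
    rw [inv_inv, mul_assoc, ← h1, Units.inv_mul_cancel_left]

end groups

/-- The matrix `I_{p,q} = diag(1, …, 1, -1, …, -1)`. -/
noncomputable def signMatrix (p q : ℕ) : Matrix (Fin p ⊕ Fin q) (Fin p ⊕ Fin q) ℍ[ℝ] :=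
  Matrix.fromBlocks 1 0 0 (-1)

/-- The group `Sp(p,q)`. -/
noncomputable def Sp (p q : ℕ) : Subgroup (Matrix (Fin p ⊕ Fin q) (Fin p ⊕ Fin q) ℍ[ℝ])ˣ :=
  formGroup (signMatrix p q)

/-- The Lie algebra `sp(p,q)`. -/
noncomputable def sp (p q : ℕ) : LieSubalgebra ℝ (Matrix (Fin p ⊕ Fin q) (Fin p ⊕ Fin q) ℍ[ℝ]) :=
  formLie (signMatrix p q)

/-- The quaternion unit `j`. -/
noncomputable def unitJ : ℍ[ℝ] := ⟨0, 0, 1, 0⟩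

/-- The group `SO*(2m)`, realized as the group of all `g ∈ SL_m(ℍ)` with `ḡᵗ (j I_m) g = j I_m`. -/
noncomputable def SOStar (m : ℕ) : Subgroup (Matrix (Fin m) (Fin m) ℍ[ℝ])ˣ :=
  formGroup (Matrix.diagonal fun _ => unitJ)

section modules

variable {n : Type} [Fintype n]

/-- A real subspace of the column space `ℍⁿ` that is invariant under `X`, `H` and `Y`, hence under
their real span. -/
def IsInvariant (X H Y : Matrix n n ℍ[ℝ]) (A : Submodule ℝ (n → ℍ[ℝ])) : Prop :=
  ∀ v ∈ A, X *ᵥ v ∈ A ∧ H *ᵥ v ∈ A ∧ Y *ᵥ v ∈ A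

/-- A nonzero irreducible real submodule of `ℍⁿ` for the span of `X`, `H` and `Y`. -/
def IsIrreducibleSub (X H Y : Matrix n n ℍ[ℝ]) (A : Submodule ℝ (n → ℍ[ℝ])) : Prop :=
  IsInvariant X H Y A ∧ A ≠ ⊥ ∧ ∀ B ≤ A, IsInvariant X H Y B → B = ⊥ ∨ B = A

/-- The set `ℕ_𝐝` of the real dimensions of the nonzero irreducible submodules of `ℍⁿ`. -/
def dims (X H Y : Matrix n n ℍ[ℝ]) : Set ℕ :=
  {d | ∃ A, IsIrreducibleSub X H Y A ∧ Module.finrank ℝ A = d}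

/-- The isotypical component `M(d-1)`: the sum of the irreducible submodules of real
dimension `d`. -/
noncomputable def isotypic (X H Y : Matrix n n ℍ[ℝ]) (d : ℕ) : Submodule ℝ (n → ℍ[ℝ]) :=
  sSup {A | IsIrreducibleSub X H Y A ∧ Module.finrank ℝ A = d}

theorem IsInvariant.map {X H Y : Matrix n n ℍ[ℝ]} {A : Submodule ℝ (n → ℍ[ℝ])}
    (hA : IsInvariant X H Y A) (c : ℍ[ℝ]ᵐᵒᵖˣ) :
    IsInvariant X H Y
      (A.map (DistribMulAction.toLinearEquiv ℝ (n → ℍ[ℝ]) c : (n → ℍ[ℝ]) →ₗ[ℝ] (n → ℍ[ℝ]))) := by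
  rintro _ ⟨v, hv, rfl⟩
  obtain ⟨h1, h2, h3⟩ := hA v hv
  refine ⟨⟨_, h1, ?_⟩, ⟨_, h2, ?_⟩, ⟨_, h3, ?_⟩⟩ <;>
    exact (Matrix.mulVec_smul _ (c : ℍ[ℝ]ᵐᵒᵖ) v).symm

theorem map_inv_map {m : Type} (c : ℍ[ℝ]ᵐᵒᵖˣ) (A : Submodule ℝ (m → ℍ[ℝ])) :
    (A.map (DistribMulAction.toLinearEquiv ℝ (m → ℍ[ℝ]) c⁻¹ :
      (m → ℍ[ℝ]) →ₗ[ℝ] (m → ℍ[ℝ]))).map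
      (DistribMulAction.toLinearEquiv ℝ (m → ℍ[ℝ]) c : (m → ℍ[ℝ]) →ₗ[ℝ] (m → ℍ[ℝ])) = A := by
  ext v
  constructor
  · rintro ⟨_, ⟨w, hw, rfl⟩, rfl⟩
    simpa using hw
  · intro hv
    exact ⟨c⁻¹ • v, ⟨v, hv, rfl⟩, by simp⟩

theorem IsIrreducibleSub.map {X H Y : Matrix n n ℍ[ℝ]} {A : Submodule ℝ (n → ℍ[ℝ])}
    (hA : IsIrreducibleSub X H Y A) (c : ℍ[ℝ]ᵐᵒᵖˣ) :
    IsIrreducibleSub X H Y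
      (A.map (DistribMulAction.toLinearEquiv ℝ (n → ℍ[ℝ]) c : (n → ℍ[ℝ]) →ₗ[ℝ] (n → ℍ[ℝ]))) := by
  obtain ⟨h1, h2, h3⟩ := hA
  refine ⟨h1.map c, ?_, fun B hB hBi => ?_⟩
  · rwa [Ne, Submodule.map_eq_bot_iff]
  · have h4 := map_inv_map c⁻¹ A
    rw [inv_inv] at h4
    rcases h3 _ ((Submodule.map_mono hB).trans_eq h4) (hBi.map c⁻¹) with h | h
    · left
      have := map_inv_map c B
      rw [h, Submodule.map_bot] at this
      exact this.symm
    · right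
      have := map_inv_map c B
      rw [h] at this
      exact this.symm

/-- The isotypical component is stable under right multiplication by quaternions. -/
theorem smul_mem_isotypic {X H Y : Matrix n n ℍ[ℝ]} {d : ℕ} (c : ℍ[ℝ]ᵐᵒᵖ) {v : n → ℍ[ℝ]}
    (hv : v ∈ isotypic X H Y d) : c • v ∈ isotypic X H Y d := by
  by_cases hc : c = 0
  · simp [hc]
  · have h : isotypic X H Y d ≤ (isotypic X H Y d).comap
        (DistribMulAction.toLinearEquiv ℝ (n → ℍ[ℝ]) (Units.mk0 c hc) :
          (n → ℍ[ℝ]) →ₗ[ℝ] (n → ℍ[ℝ])) := by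
      refine sSup_le ?_
      rintro A ⟨hA, hd⟩
      rw [← Submodule.map_le_iff_le_comap]
      exact le_sSup ⟨hA.map _, (LinearEquiv.finrank_map_eq _ A).trans hd⟩
    exact h hv

/-- The space `L(d-1) = {v ∈ M(d-1) | Y v = 0}`, a subspace of the right quaternionic vector space
of columns `ℍⁿ`. -/
noncomputable def lowest (X H Y : Matrix n n ℍ[ℝ]) (d : ℕ) : Submodule ℍ[ℝ]ᵐᵒᵖ (n → ℍ[ℝ]) where
  carrier := {v | v ∈ isotypic X H Y d ∧ Y *ᵥ v = 0}
  zero_mem' := ⟨Submodule.zero_mem _, Matrix.mulVec_zero _⟩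
  add_mem' := by
    rintro a b ⟨ha, ha'⟩ ⟨hb, hb'⟩
    exact ⟨Submodule.add_mem _ ha hb, by rw [Matrix.mulVec_add, ha', hb', add_zero]⟩
  smul_mem' := by
    rintro c a ⟨ha, ha'⟩
    exact ⟨smul_mem_isotypic c ha, by rw [Matrix.mulVec_smul, ha', smul_zero]⟩

/-- The multiplicity `t_d`, the dimension of `L(d-1)` over the quaternions. -/
noncomputable def mult (X H Y : Matrix n n ℍ[ℝ]) (d : ℕ) : ℕ :=
  Module.finrank ℍ[ℝ]ᵐᵒᵖ (lowest X H Y d)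

/-- The form `(v, u)_d = ⟨v, X^(d-1) u⟩`, where `⟨x, y⟩ = x̄ᵗ J y`. -/
noncomputable def inducedForm [DecidableEq n] (J X : Matrix n n ℍ[ℝ]) (d : ℕ) (v u : n → ℍ[ℝ]) : ℍ[ℝ] :=
  star v ⬝ᵥ (J *ᵥ (X ^ (d - 1) *ᵥ u))

/-- The restriction of the sesquilinear form `B` to the right quaternionic subspace `W` is
Hermitian and non-degenerate of signature `(a, b)`: there is an orthogonal basis of `W` that
consists of `a` vectors with `B v v = 1` and `b` vectors with `B v v = -1`. -/
def HasSignature (B : (n → ℍ[ℝ]) → (n → ℍ[ℝ]) → ℍ[ℝ]) (W : Submodule ℍ[ℝ]ᵐᵒᵖ (n → ℍ[ℝ]))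
    (a b : ℕ) : Prop :=
  ∃ e : Module.Basis (Fin a ⊕ Fin b) ℍ[ℝ]ᵐᵒᵖ W,
    ∀ i j, B (e i : n → ℍ[ℝ]) (e j : n → ℍ[ℝ]) = signMatrix a b i j

end modules

end QuatForm

/-! The column space is spanned by the vectors `X ^ l v` with `v` in a lowest weight space `L(d-1)`
and `l < d`. Hence an endomorphism commuting with the triple is determined by its restrictions to
the spaces `L(d-1)`, and any quaternion-linear maps of these spaces occur. Since `X` and `H` are
skew for the form, comparing weights shows that `⟨X ^ l v, X ^ l' u⟩`, for `v` in `L(d-1)` and `u`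
in `L(d'-1)`, vanishes unless `d = d'` and `l + l' = d - 1`; the remaining values are `±(v, u)_d`.
So the endomorphism is an isometry exactly when each restriction preserves `(·,·)_d`, and the
centralizer is the product of the isometry groups of these forms. Extension (`assemble`) and
restriction are given by multiplication with fixed matrices, so both are continuous
(`centralizerEquiv`).

Moving `X ^ (d - 1)` across the form costs the sign `(-1) ^ (d - 1)`: `(·,·)_d` is Hermitian for odd
`d` and skew-Hermitian for even `d`, and it is non-degenerate (`eq_zero_of_inducedForm_eq_zero`).
Gram-Schmidt (`exists_basis`) diagonalizes it. A nonzero real diagonal value rescales to `±1`, which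
gives `Sp(p_θ, q_θ)`; a nonzero imaginary one can always be turned into `j`, which gives
`SO*(2t_η)`. The reduced norm condition is automatic for isometries, because reduced norms are
nonnegative (`mem_formGroup_iff`).

The representation theory holds over any field of characteristic zero. It rests on
`eq_zero_of_yx_eq_zero`, on the splitting of the space into `ker Y` and `range X`, and on the
Casimir operator, which tells the isotypical components apart. -/

namespace SlTwo

/-! ### Commutation relations and nilpotency -/

variable {𝕜 V : Type*} [Field 𝕜] [AddCommGroup V] [Module 𝕜 V]

/-- The commutation relations of an `sl₂`-triple in an endomorphism algebra. -/
structure Relations (X H Y : Module.End 𝕜 V) : Prop where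
  xy : X * Y = Y * X + H
  hx : H * X = X * H + (2 : 𝕜) • X
  hy : H * Y = Y * H - (2 : 𝕜) • Y

/-- The vectors of weight `-k` that are killed by `Y`. -/
def lowestWeight (H Y : Module.End 𝕜 V) (k : ℕ) : Submodule 𝕜 V :=
  LinearMap.ker Y ⊓ LinearMap.ker (H + (k : 𝕜) • 1)

variable {X H Y : Module.End 𝕜 V}

theorem mem_lowestWeight {k : ℕ} {v : V} :
    v ∈ lowestWeight H Y k ↔ Y v = 0 ∧ H v = -(k : 𝕜) • v := by
  simp [lowestWeight, add_eq_zero_iff_eq_neg]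

namespace Relations

theorem symm (h : Relations X H Y) : Relations Y (-H) X where
  xy := by rw [h.xy]; abel
  hx := by rw [neg_mul, h.hy, mul_neg]; abel
  hy := by rw [neg_mul, h.hx, mul_neg]; abel

theorem xy_apply (h : Relations X H Y) (v : V) : X (Y v) = Y (X v) + H v :=
  LinearMap.congr_fun h.xy v

theorem hx_apply (h : Relations X H Y) (v : V) : H (X v) = X (H v) + (2 : 𝕜) • X v :=
  LinearMap.congr_fun h.hx v

theorem hy_apply (h : Relations X H Y) (v : V) : H (Y v) = Y (H v) - (2 : 𝕜) • Y v :=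
  LinearMap.congr_fun h.hy v

theorem h_pow_x (h : Relations X H Y) (l : ℕ) (v : V) :
    H ((X ^ l) v) = (X ^ l) (H v) + (2 * l : 𝕜) • (X ^ l) v := by
  induction l with
  | zero => simp
  | succ l ih =>
    simp only [pow_succ', Module.End.mul_apply]
    rw [h.hx_apply, ih, map_add, map_smul, add_assoc, ← add_smul]
    push_cast
    congr 2
    ring

theorem y_pow_x (h : Relations X H Y) (l : ℕ) (v : V) :
    Y ((X ^ (l + 1)) v) =
      (X ^ (l + 1)) (Y v) - (l + 1 : 𝕜) • (X ^ l) (H v + (l : 𝕜) • v) := by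
  induction l generalizing v with
  | zero => simp [h.xy_apply]
  | succ l ih =>
    have e1 : (X ^ (l + 1 + 1)) v = X ((X ^ (l + 1)) v) := by
      rw [pow_succ' X (l + 1)]; rfl
    have e2 : Y (X ((X ^ (l + 1)) v)) = X (Y ((X ^ (l + 1)) v)) - H ((X ^ (l + 1)) v) := by
      rw [h.xy_apply]; abel
    have e3 (w : V) : X ((X ^ (l + 1)) w) = (X ^ (l + 1 + 1)) w := by
      rw [pow_succ' X (l + 1)]; rfl
    have e4 (w : V) : X ((X ^ l) w) = (X ^ (l + 1)) w := by
      rw [pow_succ' X l]; rfl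
    rw [e1, e2, ih, h.h_pow_x, map_sub, map_smul, e3, e4]
    simp only [map_add, map_smul]
    push_cast
    module

variable [CharZero 𝕜]

/-- A nonzero power `X ^ l` is an eigenvector of `ad H` with eigenvalue `2 * l`, and there are only
finitely many eigenvalues. -/
theorem isNilpotent_x [FiniteDimensional 𝕜 V] (h : Relations X H Y) : IsNilpotent X := by
  by_contra hn
  have hX : ∀ l : ℕ, X ^ l ≠ 0 := fun l hl => hn ⟨l, hl⟩
  let adH : Module.End 𝕜 (Module.End 𝕜 V) := LinearMap.mulLeft 𝕜 H - LinearMap.mulRight 𝕜 H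
  have hev : ∀ l : ℕ, adH.HasEigenvalue (2 * l : 𝕜) := fun l => by
    refine Module.End.hasEigenvalue_of_hasEigenvector (x := X ^ l) ⟨?_, hX l⟩
    rw [Module.End.mem_eigenspace_iff]
    ext v
    simp [adH, h.h_pow_x]
  have hinj : Function.Injective fun l : ℕ => (2 * l : 𝕜) := fun a b hab => by simpa using hab
  have hfin := Module.End.finite_hasEigenvalue adH
  exact Set.infinite_of_injective_forall_mem hinj hev hfin

theorem isNilpotent_y [FiniteDimensional 𝕜 V] (h : Relations X H Y) : IsNilpotent Y :=
  h.symm.isNilpotent_x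

/-- If `X ^ (m + 1) w = 0`, then `y_pow_x` gives `(m + 1) * (c + m) • X ^ m w = 0`; so vanishing
descends from a high power of the nilpotent `X` to `w` itself. -/
theorem eq_zero_of_yx_eq_zero [FiniteDimensional 𝕜 V] (h : Relations X H Y) {w : V} {c : 𝕜}
    (hw : X (Y w) = 0) (hc : H w = c • w) (hci : ∀ i : ℕ, c + i ≠ 0) : w = 0 := by
  obtain ⟨N, hN⟩ := h.isNilpotent_x
  have key : ∀ m : ℕ, (X ^ m) w = 0 → w = 0 := by
    intro m
    induction m with
    | zero => simp
    | succ m ih =>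
      intro hm
      apply ih
      have e := h.y_pow_x m w
      have e' : (X ^ (m + 1)) (Y w) = 0 := by
        rw [pow_succ, Module.End.mul_apply, hw, map_zero]
      rw [hm, map_zero, e', hc, ← add_smul, map_smul, smul_smul, zero_sub, eq_comm,
        neg_eq_zero, smul_eq_zero] at e
      refine e.resolve_left (mul_ne_zero (Nat.cast_add_one_ne_zero m) (hci m))
  exact key N (by simp [hN])

end Relations
end SlTwo

/-! ### Weights on the kernel of `Y` and its complement -/

namespace SlTwo

variable {𝕜 V : Type*} [Field 𝕜] [AddCommGroup V] [Module 𝕜 V] {X H Y : Module.End 𝕜 V}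

/-- On the eigenspace of `H` for `-k` the operator `H + c` is the scalar `c - k`, so it maps a sum
of such eigenspaces onto itself when every `c - k` is nonzero. -/
theorem exists_shift_of_mem_iSup (p : ℕ → Prop) {U : Submodule 𝕜 V} {c : 𝕜}
    (hc : ∀ k, p k → c ≠ k) {w : V}
    (hw : w ∈ ⨆ k, ⨆ (_ : p k), U ⊓ LinearMap.ker (H + (k : 𝕜) • 1)) :
    ∃ v ∈ ⨆ k, ⨆ (_ : p k), U ⊓ LinearMap.ker (H + (k : 𝕜) • 1), H v + c • v = w := by
  have hle : (⨆ k, ⨆ (_ : p k), U ⊓ LinearMap.ker (H + (k : 𝕜) • 1)) ≤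
      (⨆ k, ⨆ (_ : p k), U ⊓ LinearMap.ker (H + (k : 𝕜) • 1)).map (H + c • 1) := by
    refine iSup₂_le fun k hk x hx => ?_
    have hne : c - k ≠ 0 := sub_ne_zero.2 (hc k hk)
    refine ⟨(c - k)⁻¹ • x, Submodule.smul_mem _ _ (Submodule.mem_iSup_of_mem k
      (Submodule.mem_iSup_of_mem hk hx)), ?_⟩
    have hx2 : H x = -(k : 𝕜) • x := by
      simpa [add_eq_zero_iff_eq_neg] using hx.2
    simp only [LinearMap.add_apply, LinearMap.smul_apply, Module.End.one_apply, map_smul, hx2]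
    rw [← add_smul, neg_add_eq_sub, smul_smul, inv_mul_cancel₀ hne, one_smul]
  obtain ⟨v, hv, h⟩ := hle hw
  exact ⟨v, hv, by simpa using h⟩

namespace Relations

theorem y_h_eq_zero (h : Relations X H Y) {v : V} (hv : Y v = 0) : Y (H v) = 0 := by
  have e := h.hy_apply v
  rw [hv, map_zero, smul_zero, sub_zero] at e
  exact e.symm

variable [CharZero 𝕜] [FiniteDimensional 𝕜 V]

/-- For `v` in `ker Y` with `X ^ (m + 1) v = 0`, `y_pow_x` shows that `X ^ m` kills `(H + m) v`.
Induction on the nilpotency exponent then diagonalizes `H` on `U` without any assumption on the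
field being algebraically closed. -/
theorem le_iSup_weight (h : Relations X H Y) {U : Submodule 𝕜 V} (hUY : U ≤ LinearMap.ker Y)
    (hUH : ∀ v ∈ U, H v ∈ U) : U ≤ ⨆ k : ℕ, U ⊓ LinearMap.ker (H + (k : 𝕜) • 1) := by
  obtain ⟨N, hN⟩ := h.isNilpotent_x
  have key : ∀ m : ℕ, ∀ v ∈ U, (X ^ m) v = 0 →
      v ∈ ⨆ k, ⨆ (_ : k < m), U ⊓ LinearMap.ker (H + (k : 𝕜) • 1) := by
    intro m
    induction m with
    | zero =>
      intro v _ hv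
      simpa using hv
    | succ m ih =>
      intro v hv hm
      have hmono : (⨆ k, ⨆ (_ : k < m), U ⊓ LinearMap.ker (H + (k : 𝕜) • 1)) ≤
          ⨆ k, ⨆ (_ : k < m + 1), U ⊓ LinearMap.ker (H + (k : 𝕜) • 1) :=
        biSup_mono fun k hk => Nat.lt_succ_of_lt hk
      have e := h.y_pow_x m v
      rw [hm, hUY hv, map_zero, map_zero, zero_sub, eq_comm, neg_eq_zero, smul_eq_zero] at e
      have hw := ih _ (U.add_mem (hUH v hv) (U.smul_mem _ hv))
        (e.resolve_left (Nat.cast_add_one_ne_zero m))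
      -- Invert `H + m` on the weights below `m`: the correction `v'` makes `v - v'` an eigenvector
      -- of weight `-m`.
      obtain ⟨v', hv', h'⟩ := exists_shift_of_mem_iSup (fun k => k < m) (c := (m : 𝕜))
        (fun k hk hmk => hk.ne' (by exact_mod_cast hmk)) hw
      have hv'U : v' ∈ U := (iSup₂_le fun k _ => inf_le_left :
        (⨆ k, ⨆ (_ : k < m), U ⊓ LinearMap.ker (H + (k : 𝕜) • 1)) ≤ U) hv'
      have hd : v - v' ∈ ⨆ k, ⨆ (_ : k < m + 1), U ⊓ LinearMap.ker (H + (k : 𝕜) • 1) := by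
        refine Submodule.mem_iSup_of_mem m (Submodule.mem_iSup_of_mem (Nat.lt_succ_self m)
          ⟨U.sub_mem hv hv'U, ?_⟩)
        change H (v - v') + (m : 𝕜) • (v - v') = 0
        rw [map_sub, smul_sub, sub_add_sub_comm, h', sub_self]
      simpa using Submodule.add_mem _ hd (hmono hv')
  intro v hv
  exact (iSup_mono fun k => iSup_le fun _ => le_rfl :
    (⨆ k, ⨆ (_ : k < N), U ⊓ LinearMap.ker (H + (k : 𝕜) • 1)) ≤ _) (key N v hv (by simp [hN]))

/-- If `X w` lies in `ker Y` with weight `-k`, then `w` has weight `-(k + 2)` up to an element of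
`ker X`. That element can be corrected away, and `eq_zero_of_yx_eq_zero` for the opposite triple
`(Y, -H, X)` puts `w` in `ker X`. -/
theorem disjoint_ker_range (h : Relations X H Y) :
    LinearMap.ker Y ⊓ LinearMap.range X = ⊥ := by
  set U := LinearMap.ker Y ⊓ LinearMap.range X with hU
  have hle := h.le_iSup_weight (U := U) inf_le_left (by
    rintro _ ⟨hv, w, rfl⟩
    refine ⟨?_, H w + (2 : 𝕜) • w, by rw [h.hx_apply, map_add, map_smul]⟩
    exact h.y_h_eq_zero hv)
  rw [eq_bot_iff]
  refine hle.trans (iSup_le fun k => ?_)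
  rintro _ ⟨⟨hv, w, rfl⟩, hk⟩
  have hk' : H (X w) = -(k : 𝕜) • X w := by simpa [add_eq_zero_iff_eq_neg] using hk
  replace hv : Y (X w) = 0 := hv
  have hw' : (-H) w + (-(k + 2) : 𝕜) • w ∈ LinearMap.ker X := by
    have e := h.hx_apply w
    rw [hk'] at e
    rw [LinearMap.mem_ker, map_add, map_smul, LinearMap.neg_apply, map_neg,
      eq_sub_of_add_eq e.symm]
    module
  have hs := h.symm
  have hX := hs.le_iSup_weight (U := LinearMap.ker X) le_rfl fun v hv => hs.y_h_eq_zero hv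
  have hmem : (-H) w + (-(k + 2) : 𝕜) • w ∈
      ⨆ j : ℕ, ⨆ (_ : True), LinearMap.ker X ⊓ LinearMap.ker (-H + (j : 𝕜) • 1) := by
    simpa using hX hw'
  obtain ⟨v', hv', he⟩ := exists_shift_of_mem_iSup (fun _ => True) (c := (-(k + 2) : 𝕜))
    (fun j _ hj => by
      have : ((k + 2 + j : ℕ) : 𝕜) = 0 := by
        push_cast
        rw [← hj]
        ring
      exact absurd (Nat.cast_eq_zero.1 this) (by omega)) hmem
  have hXv' : X v' = 0 := (iSup₂_le fun _ _ => inf_le_left :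
    (⨆ j : ℕ, ⨆ (_ : True), LinearMap.ker X ⊓ LinearMap.ker (-H + (j : 𝕜) • 1)) ≤
      LinearMap.ker X) hv'
  have h0 : w - v' = 0 := by
    refine hs.eq_zero_of_yx_eq_zero (c := (k + 2 : 𝕜)) ?_ ?_ fun i hi => ?_
    · rw [map_sub, hXv', sub_zero, hv]
    · rw [map_sub, ← sub_eq_zero]
      have : (-H) w - (-H) v' - (k + 2 : 𝕜) • (w - v') =
        ((-H) w + (-(k + 2) : 𝕜) • w) - ((-H) v' + (-(k + 2) : 𝕜) • v') := by module
      rw [this, he, sub_self]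
    · have : ((k + 2 + i : ℕ) : 𝕜) = 0 := by
        push_cast
        exact hi
      exact absurd (Nat.cast_eq_zero.1 this) (by omega)
  rw [sub_eq_zero.1 h0, hXv']
  exact Submodule.zero_mem _

theorem finrank_ker_y_le (h : Relations X H Y) :
    Module.finrank 𝕜 (LinearMap.ker Y) ≤ Module.finrank 𝕜 (LinearMap.ker X) := by
  have h1 := Submodule.finrank_sup_add_finrank_inf_eq (LinearMap.ker Y) (LinearMap.range X)
  rw [h.disjoint_ker_range, finrank_bot, add_zero] at h1
  have h2 := LinearMap.finrank_range_add_finrank_ker X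
  have h3 := Submodule.finrank_le (LinearMap.ker Y ⊔ LinearMap.range X)
  omega

/-- Disjointness bounds `dim ker Y` by `dim ker X`; the opposite triple gives the reverse bound, and
then the dimensions add up. -/
theorem ker_sup_range (h : Relations X H Y) : LinearMap.ker Y ⊔ LinearMap.range X = ⊤ := by
  apply Submodule.eq_top_of_finrank_eq
  have h1 := Submodule.finrank_sup_add_finrank_inf_eq (LinearMap.ker Y) (LinearMap.range X)
  rw [h.disjoint_ker_range, finrank_bot, add_zero] at h1
  have h2 := LinearMap.finrank_range_add_finrank_ker X
  have h3 := h.finrank_ker_y_le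
  have h4 := h.symm.finrank_ker_y_le
  omega

theorem ker_y_eq_iSup (h : Relations X H Y) :
    LinearMap.ker Y = ⨆ k : ℕ, lowestWeight H Y k := by
  refine le_antisymm (h.le_iSup_weight le_rfl fun v hv => h.y_h_eq_zero hv)
    (iSup_le fun k => inf_le_left)

/-- The whole space is spanned by the vectors `X ^ l v` with `v` a lowest weight vector. -/
theorem eq_top_of_forall_mem (h : Relations X H Y) {S : Submodule 𝕜 V}
    (hS : ∀ (k l : ℕ), ∀ v ∈ lowestWeight H Y k, (X ^ l) v ∈ S) : S = ⊤ := by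
  obtain ⟨N, hN⟩ := h.isNilpotent_x
  have hker : ∀ l : ℕ, ∀ v ∈ LinearMap.ker Y, (X ^ l) v ∈ S := fun l => by
    have : LinearMap.ker Y ≤ S.comap (X ^ l) := by
      rw [h.ker_y_eq_iSup]
      exact iSup_le fun k v hv => hS k l v hv
    exact fun v hv => this hv
  -- Iterating the splitting into `ker Y` and `range X` pushes the remainder into the range of ever
  -- higher powers of `X`, which is eventually zero.
  have key : ∀ m : ℕ, S ⊔ LinearMap.range (X ^ m) = ⊤ := by
    intro m
    induction m with
    | zero => simp [Module.End.one_eq_id]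
    | succ m ih =>
      rw [eq_top_iff, ← ih]
      refine sup_le le_sup_left ?_
      rintro _ ⟨v, rfl⟩
      have hv : v ∈ LinearMap.ker Y ⊔ LinearMap.range X := by
        rw [h.ker_sup_range]
        trivial
      obtain ⟨a, ha, _, ⟨b, rfl⟩, rfl⟩ := Submodule.mem_sup.1 hv
      rw [map_add]
      exact Submodule.add_mem _ (Submodule.mem_sup_left (hker m a ha))
        (Submodule.mem_sup_right ⟨b, by rw [pow_succ]; rfl⟩)
  simpa [hN] using key N

end Relations
end SlTwo

/-! ### Irreducible subspaces and the Casimir operator -/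

namespace SlTwo

variable {𝕜 V : Type*} [Field 𝕜] [AddCommGroup V] [Module 𝕜 V]

/-- A subspace that is invariant under `X`, `H` and `Y`. -/
def IsInvariant (X H Y : Module.End 𝕜 V) (A : Submodule 𝕜 V) : Prop :=
  ∀ v ∈ A, X v ∈ A ∧ H v ∈ A ∧ Y v ∈ A

/-- A nonzero invariant subspace without proper nonzero invariant subspaces. -/
def IsIrreducible (X H Y : Module.End 𝕜 V) (A : Submodule 𝕜 V) : Prop :=
  IsInvariant X H Y A ∧ A ≠ ⊥ ∧ ∀ B ≤ A, IsInvariant X H Y B → B = ⊥ ∨ B = A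

/-- The span of `v, X v, …, X ^ k v`. -/
def cyclicSpan (X : Module.End 𝕜 V) (k : ℕ) (v : V) : Submodule 𝕜 V :=
  Submodule.span 𝕜 (Set.range fun l : Fin (k + 1) => (X ^ (l : ℕ)) v)

/-- The Casimir operator `4 X Y + (H - 1) ^ 2`. -/
def casimir (X H Y : Module.End 𝕜 V) : Module.End 𝕜 V :=
  (4 : 𝕜) • (X * Y) + (H - 1) * (H - 1)

variable {X H Y : Module.End 𝕜 V}

theorem pow_mem_cyclicSpan {k l : ℕ} (hl : l ≤ k) (v : V) : (X ^ l) v ∈ cyclicSpan X k v :=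
  Submodule.subset_span ⟨⟨l, Nat.lt_succ_of_le hl⟩, rfl⟩

theorem mem_cyclicSpan (k : ℕ) (v : V) : v ∈ cyclicSpan X k v := by
  simpa using pow_mem_cyclicSpan (X := X) (Nat.zero_le k) v

theorem IsInvariant.pow_mem {A : Submodule 𝕜 V} (hA : IsInvariant X H Y A) {v : V} (hv : v ∈ A)
    (l : ℕ) : (X ^ l) v ∈ A := by
  induction l with
  | zero => simpa
  | succ l ih =>
    rw [pow_succ']
    exact (hA _ ih).1

theorem IsInvariant.cyclicSpan_le {A : Submodule 𝕜 V} (hA : IsInvariant X H Y A) {v : V}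
    (hv : v ∈ A) (k : ℕ) : cyclicSpan X k v ≤ A := by
  rw [cyclicSpan, Submodule.span_le]
  rintro _ ⟨l, rfl⟩
  exact hA.pow_mem hv l

namespace Relations

theorem h_pow_x_lowestWeight (h : Relations X H Y) {k : ℕ} {v : V} (hv : v ∈ lowestWeight H Y k)
    (l : ℕ) : H ((X ^ l) v) = (2 * l - k : 𝕜) • (X ^ l) v := by
  rw [h.h_pow_x, (mem_lowestWeight.1 hv).2, map_smul, ← add_smul]
  congr 1
  ring

theorem y_pow_x_lowestWeight (h : Relations X H Y) {k : ℕ} {v : V} (hv : v ∈ lowestWeight H Y k)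
    (l : ℕ) : Y ((X ^ (l + 1)) v) = ((l + 1) * (k - l) : 𝕜) • (X ^ l) v := by
  obtain ⟨hY, hH⟩ := mem_lowestWeight.1 hv
  rw [h.y_pow_x, hY, map_zero, hH, ← add_smul, map_smul, smul_smul, zero_sub, ← neg_smul]
  congr 1
  ring

theorem casimir_x (h : Relations X H Y) : casimir X H Y * X = X * casimir X H Y := by
  have e1 : X * X * Y = X * Y * X + X * H := by
    simpa only [mul_add, mul_assoc] using congrArg (X * ·) h.xy
  have e2 : H * H * X = X * H * H + (4 : 𝕜) • (X * H) + (4 : 𝕜) • X := by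
    rw [mul_assoc, h.hx, mul_add, ← mul_assoc, h.hx, mul_smul_comm, h.hx, add_mul, smul_mul_assoc]
    module
  have l : casimir X H Y * X =
      (4 : 𝕜) • (X * Y * X) + H * H * X - (2 : 𝕜) • (H * X) + X := by
    simp only [casimir, add_mul, smul_mul_assoc, sub_mul, mul_sub, mul_one, one_mul]
    module
  have r : X * casimir X H Y =
      (4 : 𝕜) • (X * X * Y) + X * H * H - (2 : 𝕜) • (X * H) + X := by
    simp only [casimir, mul_add, mul_smul_comm, mul_sub, sub_mul, mul_one, one_mul, mul_assoc]
    module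
  rw [l, r, e1, e2, h.hx]
  module

/-- The eigenvalues `(k + 1) ^ 2` are distinct for distinct natural numbers `k`, so the Casimir
operator detects the highest power `k`. -/
theorem casimir_lowestWeight {k : ℕ} {v : V} (hv : v ∈ lowestWeight H Y k) :
    casimir X H Y v = ((k + 1) ^ 2 : 𝕜) • v := by
  obtain ⟨hY, hH⟩ := mem_lowestWeight.1 hv
  have e : casimir X H Y v = (4 : 𝕜) • X (Y v) + (H (H v - v) - (H v - v)) := rfl
  rw [e, hY, map_zero, map_sub, hH, map_smul, hH]
  module

theorem casimir_cyclicSpan (h : Relations X H Y) {k : ℕ} {v w : V}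
    (hv : v ∈ lowestWeight H Y k) (hw : w ∈ cyclicSpan X k v) :
    casimir X H Y w = ((k + 1) ^ 2 : 𝕜) • w := by
  have hle : cyclicSpan X k v ≤
      LinearMap.ker (casimir X H Y - ((k + 1) ^ 2 : 𝕜) • 1) := by
    rw [cyclicSpan, Submodule.span_le]
    rintro _ ⟨l, rfl⟩
    have hc : Commute (casimir X H Y) (X ^ (l : ℕ)) := Commute.pow_right h.casimir_x _
    have e := LinearMap.congr_fun hc.eq v
    rw [Module.End.mul_apply, Module.End.mul_apply, casimir_lowestWeight hv, map_smul] at e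
    simp [e]
  have := hle hw
  rwa [LinearMap.mem_ker, LinearMap.sub_apply, sub_eq_zero] at this

variable [CharZero 𝕜]

theorem pow_x_ne_zero (h : Relations X H Y) {k : ℕ} {v : V} (hv : v ∈ lowestWeight H Y k)
    (hv0 : v ≠ 0) {l : ℕ} (hl : l ≤ k) : (X ^ l) v ≠ 0 := by
  induction l with
  | zero => simpa
  | succ l ih =>
    intro h0
    have e := h.y_pow_x_lowestWeight hv l
    rw [h0, map_zero, eq_comm, smul_eq_zero] at e
    refine ih (by omega) (e.resolve_left (mul_ne_zero (Nat.cast_add_one_ne_zero l) ?_))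
    exact sub_ne_zero.2 (by exact_mod_cast (by omega : k ≠ l))

theorem finrank_cyclicSpan (h : Relations X H Y) {k : ℕ} {v : V} (hv : v ∈ lowestWeight H Y k)
    (hv0 : v ≠ 0) : Module.finrank 𝕜 (cyclicSpan X k v) = k + 1 := by
  have hli : LinearIndependent 𝕜 fun l : Fin (k + 1) => (X ^ (l : ℕ)) v := by
    refine Module.End.eigenvectors_linearIndependent' H (fun l : Fin (k + 1) => (2 * l - k : 𝕜))
      (fun a b hab => ?_) _ fun l => ⟨?_, h.pow_x_ne_zero hv hv0 (Nat.lt_succ_iff.1 l.2)⟩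
    · have : (a : 𝕜) = (b : 𝕜) := by simpa using hab
      exact Fin.ext (by exact_mod_cast this)
    · rw [Module.End.mem_eigenspace_iff]
      exact h.h_pow_x_lowestWeight hv l
  rw [cyclicSpan, finrank_span_eq_card hli, Fintype.card_fin]

variable [FiniteDimensional 𝕜 V]

/-- The vector `X ^ (k + 1) v` is killed by `Y` but has positive weight `k + 2`, which
`eq_zero_of_yx_eq_zero` forbids for a nonzero vector. -/
theorem pow_x_eq_zero (h : Relations X H Y) {k : ℕ} {v : V} (hv : v ∈ lowestWeight H Y k)
    {l : ℕ} (hl : k < l) : (X ^ l) v = 0 := by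
  have h0 : (X ^ (k + 1)) v = 0 := by
    have hY : Y ((X ^ (k + 1)) v) = 0 := by
      rw [h.y_pow_x_lowestWeight hv, sub_self, mul_zero, zero_smul]
    refine h.eq_zero_of_yx_eq_zero (c := (k + 2 : 𝕜)) (by rw [hY, map_zero]) ?_ fun i hi => ?_
    · rw [h.h_pow_x_lowestWeight hv]
      congr 1
      push_cast
      ring
    · have : ((k + 2 + i : ℕ) : 𝕜) = 0 := by
        push_cast
        exact hi
      exact absurd (Nat.cast_eq_zero.1 this) (by omega)
  obtain ⟨m, rfl⟩ := Nat.exists_eq_add_of_lt hl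
  rw [show k + m + 1 = m + (k + 1) by ring, pow_add, Module.End.mul_apply, h0, map_zero]

theorem isInvariant_cyclicSpan (h : Relations X H Y) {k : ℕ} {v : V}
    (hv : v ∈ lowestWeight H Y k) : IsInvariant X H Y (cyclicSpan X k v) := by
  have hle : cyclicSpan X k v ≤ (cyclicSpan X k v).comap X ⊓
      ((cyclicSpan X k v).comap H ⊓ (cyclicSpan X k v).comap Y) := by
    conv_lhs => rw [cyclicSpan]
    rw [Submodule.span_le]
    rintro _ ⟨⟨l, hl⟩, rfl⟩
    refine ⟨?_, ?_, ?_⟩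
    · change X ((X ^ l) v) ∈ cyclicSpan X k v
      rw [← Module.End.mul_apply, ← pow_succ']
      rcases Nat.lt_or_ge k (l + 1) with hk | hk
      · rw [h.pow_x_eq_zero hv hk]
        exact Submodule.zero_mem _
      · exact pow_mem_cyclicSpan hk v
    · change H ((X ^ l) v) ∈ cyclicSpan X k v
      rw [h.h_pow_x_lowestWeight hv]
      exact Submodule.smul_mem _ _ (pow_mem_cyclicSpan (by omega) v)
    · change Y ((X ^ l) v) ∈ cyclicSpan X k v
      rcases l with _ | l
      · simp [(mem_lowestWeight.1 hv).1]
      · rw [h.y_pow_x_lowestWeight hv]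
        exact Submodule.smul_mem _ _ (pow_mem_cyclicSpan (by omega) v)
  exact fun w hw => hle hw

theorem exists_lowestWeight_mem (h : Relations X H Y) {A : Submodule 𝕜 V}
    (hA : IsInvariant X H Y A) (h0 : A ≠ ⊥) : ∃ k, ∃ v ∈ lowestWeight H Y k, v ≠ 0 ∧ v ∈ A := by
  have hU : A ⊓ LinearMap.ker Y ≠ ⊥ := by
    intro hbot
    obtain ⟨N, hN⟩ := h.isNilpotent_y
    have key : ∀ m : ℕ, ∀ v ∈ A, (Y ^ m) v = 0 → v = 0 := by
      intro m
      induction m with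
      | zero => simp
      | succ m ih =>
        intro v hv hm
        have hY : Y v = 0 := ih _ (hA v hv).2.2 (by rwa [pow_succ] at hm)
        have : v ∈ A ⊓ LinearMap.ker Y := ⟨hv, hY⟩
        rwa [hbot] at this
    exact h0 (eq_bot_iff.2 fun v hv => key N v hv (by simp [hN]))
  have hle := h.le_iSup_weight (U := A ⊓ LinearMap.ker Y) inf_le_right
    fun v hv => ⟨(hA v hv.1).2.1, h.y_h_eq_zero hv.2⟩
  by_contra! hcon
  refine hU (eq_bot_iff.2 (hle.trans (iSup_le fun k v hv => ?_)))
  by_contra hv0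
  exact hcon k v ⟨hv.1.2, hv.2⟩ hv0 hv.1.1

/-- A nonzero invariant subspace contains a lowest weight vector; its Casimir eigenvalue forces the
same `k`, so it already generates a subspace of full dimension. -/
theorem isIrreducible_cyclicSpan (h : Relations X H Y) {k : ℕ} {v : V}
    (hv : v ∈ lowestWeight H Y k) (hv0 : v ≠ 0) : IsIrreducible X H Y (cyclicSpan X k v) := by
  refine ⟨h.isInvariant_cyclicSpan hv, fun hbot => hv0 ?_, fun B hB hBi => ?_⟩
  · have := mem_cyclicSpan (X := X) k v
    rwa [hbot] at this
  · refine or_iff_not_imp_left.2 fun hB0 => ?_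
    obtain ⟨j, u, hu, hu0, huB⟩ := h.exists_lowestWeight_mem hBi hB0
    have hC := h.casimir_cyclicSpan hv (hB huB)
    rw [casimir_lowestWeight hu] at hC
    have hjk : j = k := by
      have e : ((j + 1) ^ 2 : 𝕜) = (k + 1) ^ 2 := smul_left_injective 𝕜 hu0 hC
      have e' : (j + 1) ^ 2 = (k + 1) ^ 2 := by exact_mod_cast e
      have := Nat.pow_left_injective two_ne_zero e'
      omega
    subst hjk
    refine Submodule.eq_of_le_of_finrank_le hB ?_
    rw [h.finrank_cyclicSpan hv hv0, ← h.finrank_cyclicSpan hu hu0]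
    exact Submodule.finrank_mono (hBi.cyclicSpan_le huB j)

theorem exists_eq_cyclicSpan (h : Relations X H Y) {A : Submodule 𝕜 V}
    (hA : IsIrreducible X H Y A) :
    ∃ k, ∃ v ∈ lowestWeight H Y k, v ≠ 0 ∧ A = cyclicSpan X k v := by
  obtain ⟨k, v, hv, hv0, hvA⟩ := h.exists_lowestWeight_mem hA.1 hA.2.1
  refine ⟨k, v, hv, hv0, ?_⟩
  refine ((hA.2.2 _ (hA.1.cyclicSpan_le hvA k)
    (h.isInvariant_cyclicSpan hv)).resolve_left fun hbot => hv0 ?_).symm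
  have := mem_cyclicSpan (X := X) k v
  rwa [hbot] at this

/-- The lowest weight vectors in the sum of the irreducible subspaces of dimension `k + 1`. -/
theorem mem_sSup_irreducible_and_ker_iff (h : Relations X H Y) (k : ℕ) (v : V) :
    (v ∈ sSup {A | IsIrreducible X H Y A ∧ Module.finrank 𝕜 A = k + 1} ∧ Y v = 0) ↔
      v ∈ lowestWeight H Y k := by
  constructor
  · rintro ⟨hv, hY⟩
    have hle : sSup {A | IsIrreducible X H Y A ∧ Module.finrank 𝕜 A = k + 1} ≤
        LinearMap.ker (casimir X H Y - ((k + 1) ^ 2 : 𝕜) • 1) := by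
      refine sSup_le ?_
      rintro A ⟨hA, hk⟩
      obtain ⟨j, u, hu, hu0, rfl⟩ := h.exists_eq_cyclicSpan hA
      rw [h.finrank_cyclicSpan hu hu0, Nat.add_right_cancel_iff] at hk
      subst hk
      intro w hw
      rw [LinearMap.mem_ker, LinearMap.sub_apply, sub_eq_zero]
      exact h.casimir_cyclicSpan hu hw
    have hC : casimir X H Y v = ((k + 1) ^ 2 : 𝕜) • v := by
      have := hle hv
      rwa [LinearMap.mem_ker, LinearMap.sub_apply, sub_eq_zero] at this
    have e : casimir X H Y v = (4 : 𝕜) • X (Y v) + (H (H v - v) - (H v - v)) := rfl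
    rw [e, hY, map_zero, smul_zero, zero_add, map_sub] at hC
    -- On `ker Y` the Casimir equation reads `(H - (k + 2)) (H + k) v = 0`. Hence `(H + k) v` is in
    -- `ker Y` with weight `k + 2`, and so it is zero.
    have h0 : H v + (k : 𝕜) • v = 0 := by
      refine h.eq_zero_of_yx_eq_zero (c := (k + 2 : 𝕜)) ?_ ?_ fun i hi => ?_
      · rw [map_add, map_smul, hY, h.y_h_eq_zero hY, smul_zero, add_zero, map_zero]
      · rw [map_add, map_smul]
        have e2 : H (H v) = ((k + 1) ^ 2 : 𝕜) • v + H v + (H v - v) := by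
          rw [← hC]
          abel
        rw [e2]
        module
      · have : ((k + 2 + i : ℕ) : 𝕜) = 0 := by
          push_cast
          exact hi
        exact absurd (Nat.cast_eq_zero.1 this) (by omega)
    exact ⟨hY, h0⟩
  · intro hv
    refine ⟨?_, (mem_lowestWeight.1 hv).1⟩
    by_cases hv0 : v = 0
    · rw [hv0]
      exact Submodule.zero_mem _
    · exact le_sSup (a := cyclicSpan X k v)
        (s := {A | IsIrreducible X H Y A ∧ Module.finrank 𝕜 A = k + 1})
        ⟨h.isIrreducible_cyclicSpan hv hv0, h.finrank_cyclicSpan hv hv0⟩ (mem_cyclicSpan k v)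

theorem exists_irreducible_finrank_iff (h : Relations X H Y) (d : ℕ) :
    (∃ A, IsIrreducible X H Y A ∧ Module.finrank 𝕜 A = d) ↔
      ∃ k, d = k + 1 ∧ lowestWeight H Y k ≠ ⊥ := by
  constructor
  · rintro ⟨A, hA, rfl⟩
    obtain ⟨k, v, hv, hv0, rfl⟩ := h.exists_eq_cyclicSpan hA
    exact ⟨k, h.finrank_cyclicSpan hv hv0, Submodule.ne_bot_iff _ |>.2 ⟨v, hv, hv0⟩⟩
  · rintro ⟨k, rfl, hk⟩
    obtain ⟨v, hv, hv0⟩ := (Submodule.ne_bot_iff _).1 hk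
    exact ⟨_, h.isIrreducible_cyclicSpan hv hv0, h.finrank_cyclicSpan hv hv0⟩

end Relations
end SlTwo

/-! ### Positivity of the reduced norm -/

namespace QuatForm

open scoped ComplexOrder

section reducedNorm

variable {m n : Type} [Fintype m] [DecidableEq m] [Fintype n] [DecidableEq n]

theorem toComplexMatrix_apply (A : Matrix n n ℍ[ℝ]) (i j : n × Fin 2) :
    toComplexMatrix A i j = quatToComplex (A i.1 j.1) i.2 j.2 := rfl

theorem reducedNorm_mul (A B : Matrix n n ℍ[ℝ]) :
    reducedNorm (A * B) = reducedNorm A * reducedNorm B := by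
  simp [reducedNorm]

theorem reducedNorm_one : reducedNorm (1 : Matrix n n ℍ[ℝ]) = 1 := by
  simp [reducedNorm]

theorem reducedNorm_submatrix (e : m ≃ n) (A : Matrix n n ℍ[ℝ]) :
    reducedNorm (A.submatrix e e) = reducedNorm A :=
  Matrix.det_submatrix_equiv_self (e.prodCongr (Equiv.refl (Fin 2))) (toComplexMatrix A)

theorem quatToComplex_star (q : ℍ[ℝ]) : quatToComplex (star q) = (quatToComplex q)ᴴ := by
  ext i j
  fin_cases i <;> fin_cases j <;> simp [quatToComplex, Complex.ext_iff]

theorem det_quatToComplex_nonneg (q : ℍ[ℝ]) : 0 ≤ (quatToComplex q).det := by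
  have h : (quatToComplex q).det =
      ((q.re ^ 2 + q.imI ^ 2 + q.imJ ^ 2 + q.imK ^ 2 : ℝ) : ℂ) := by
    simp only [quatToComplex, AlgHom.coe_mk, RingHom.coe_mk, MonoidHom.coe_mk, OneHom.coe_mk,
      Matrix.det_fin_two_of]
    apply Complex.ext
    · simp [-Complex.ofReal_pow]
      ring
    · simp [-Complex.ofReal_pow]
      ring
  rw [h]
  exact Complex.zero_le_real.2 (by positivity)

theorem toComplexMatrix_conjTranspose (A : Matrix n n ℍ[ℝ]) :
    toComplexMatrix Aᴴ = (toComplexMatrix A)ᴴ := by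
  ext i j
  rw [toComplexMatrix_apply, Matrix.conjTranspose_apply, quatToComplex_star]
  rfl

theorem reducedNorm_conjTranspose (A : Matrix n n ℍ[ℝ]) :
    reducedNorm Aᴴ = star (reducedNorm A) := by
  rw [reducedNorm, toComplexMatrix_conjTranspose, Matrix.det_conjTranspose, reducedNorm]

theorem reducedNorm_fromBlocks_zero₂₁ (A : Matrix m m ℍ[ℝ]) (B : Matrix m n ℍ[ℝ])
    (D : Matrix n n ℍ[ℝ]) :
    reducedNorm (Matrix.fromBlocks A B 0 D) = reducedNorm A * reducedNorm D := by
  rw [reducedNorm, ← Matrix.det_submatrix_equiv_self (Equiv.sumProdDistrib m n (Fin 2)).symm,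
    reducedNorm, reducedNorm, ← Matrix.det_fromBlocks_zero₂₁ _
      (Matrix.of fun i j => quatToComplex (B i.1 j.1) i.2 j.2)]
  congr 1
  ext i j
  rcases i with i | i <;> rcases j with j | j <;> simp [toComplexMatrix_apply]

theorem reducedNorm_fromBlocks_zero₁₂ (A : Matrix m m ℍ[ℝ]) (C : Matrix n m ℍ[ℝ])
    (D : Matrix n n ℍ[ℝ]) :
    reducedNorm (Matrix.fromBlocks A 0 C D) = reducedNorm A * reducedNorm D := by
  rw [reducedNorm, ← Matrix.det_submatrix_equiv_self (Equiv.sumProdDistrib m n (Fin 2)).symm,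
    reducedNorm, reducedNorm, ← Matrix.det_fromBlocks_zero₁₂ _
      (Matrix.of fun i j => quatToComplex (C i.1 j.1) i.2 j.2)]
  congr 1
  ext i j
  rcases i with i | i <;> rcases j with j | j <;> simp [toComplexMatrix_apply]

/-- Schur complement with respect to the invertible corner `D`, written with an explicit inverse
because the entries do not commute. -/
theorem reducedNorm_fromBlocks_of_mul_eq_one (A : Matrix m m ℍ[ℝ]) (B : Matrix m n ℍ[ℝ])
    (C : Matrix n m ℍ[ℝ]) (D : Matrix n n ℍ[ℝ]) {D' : Matrix n n ℍ[ℝ]} (h : D * D' = 1)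
    (h' : D' * D = 1) :
    reducedNorm (Matrix.fromBlocks A B C D) = reducedNorm (A - B * D' * C) * reducedNorm D := by
  have e : Matrix.fromBlocks A B C D = Matrix.fromBlocks 1 (B * D') 0 1 *
      Matrix.fromBlocks (A - B * D' * C) 0 0 D * Matrix.fromBlocks 1 0 (D' * C) 1 := by
    have e1 : B * D' * D = B := by rw [Matrix.mul_assoc, h', Matrix.mul_one]
    have e2 : D * (D' * C) = C := by rw [← Matrix.mul_assoc, h, Matrix.one_mul]
    simp [Matrix.fromBlocks_multiply, e1, e2, Matrix.mul_assoc]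
  rw [e, reducedNorm_mul, reducedNorm_mul, reducedNorm_fromBlocks_zero₂₁,
    reducedNorm_fromBlocks_zero₂₁, reducedNorm_fromBlocks_zero₁₂]
  simp [reducedNorm_one]

theorem continuous_reducedNorm : Continuous (reducedNorm : Matrix n n ℍ[ℝ] → ℂ) :=
  Continuous.matrix_det (LinearMap.continuous_of_finiteDimensional toComplexMatrix.toLinearMap)

theorem reducedNorm_unique [Unique n] (D : Matrix n n ℍ[ℝ]) :
    reducedNorm D = (quatToComplex (D default default)).det := by
  rw [reducedNorm, ← Matrix.det_submatrix_equiv_self (Equiv.uniqueProd (Fin 2) n).symm]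
  rfl

/-- Induction by the Schur complement of the last diagonal entry, whose own reduced norm is its
squared length. A zero entry is replaced by a nonzero real `t` that tends to zero. -/
theorem reducedNorm_nonneg_fin (k : ℕ) (A : Matrix (Fin k) (Fin k) ℍ[ℝ]) :
    0 ≤ reducedNorm A := by
  induction k with
  | zero => simp [reducedNorm]
  | succ k ih =>
    have key (A : Matrix (Fin k) (Fin k) ℍ[ℝ]) (B : Matrix (Fin k) (Fin 1) ℍ[ℝ])
        (C : Matrix (Fin 1) (Fin k) ℍ[ℝ]) (d : ℍ[ℝ]) (hd : d ≠ 0) :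
        0 ≤ reducedNorm (Matrix.fromBlocks A B C (Matrix.diagonal fun _ => d)) := by
      rw [reducedNorm_fromBlocks_of_mul_eq_one A B C _ (D' := Matrix.diagonal fun _ => d⁻¹)
        (by simp [hd]) (by simp [hd]),
        reducedNorm_unique (Matrix.diagonal fun _ : Fin 1 => d)]
      exact mul_nonneg (ih _) (det_quatToComplex_nonneg _)
    rw [← reducedNorm_submatrix finSumFinEquiv A, ← Matrix.fromBlocks_toBlocks (A.submatrix _ _)]
    set M := A.submatrix finSumFinEquiv finSumFinEquiv
    have hD : M.toBlocks₂₂ = Matrix.diagonal fun _ => M.toBlocks₂₂ 0 0 := by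
      ext1 i j
      rw [Subsingleton.elim i 0, Subsingleton.elim j 0, Matrix.diagonal_apply_eq]
    rw [hD]
    by_cases hd : M.toBlocks₂₂ 0 0 = 0
    · rw [hd]
      have hc : Continuous fun t : ℝ => reducedNorm (Matrix.fromBlocks M.toBlocks₁₁ M.toBlocks₁₂
          M.toBlocks₂₁ (Matrix.diagonal fun _ => (t : ℍ[ℝ]))) := by
        refine continuous_reducedNorm.comp ?_
        refine Continuous.matrix_fromBlocks continuous_const continuous_const continuous_const ?_
        exact Continuous.matrix_diagonal (continuous_pi fun _ => Quaternion.continuous_coe)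
      have ht := (hc.tendsto 0).mono_left (nhdsWithin_le_nhds (s := {0}ᶜ))
      have := ge_of_tendsto ht (b := 0) (by
        filter_upwards [self_mem_nhdsWithin] with t ht
        exact key _ _ _ _ (fun h0 => ht (Quaternion.coe_injective h0)))
      simpa using this
    · exact key _ _ _ _ hd

theorem reducedNorm_nonneg (A : Matrix n n ℍ[ℝ]) : 0 ≤ reducedNorm A := by
  rw [← reducedNorm_submatrix (Fintype.equivFin n).symm A]
  exact reducedNorm_nonneg_fin _ _

/-- Taking reduced norms in the isometry equation gives a norm of absolute value one, and
nonnegativity makes it equal to one. -/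
theorem mem_formGroup_iff {J : Matrix n n ℍ[ℝ]} (hJ : IsUnit J) (g : (Matrix n n ℍ[ℝ])ˣ) :
    g ∈ formGroup J ↔ (g : Matrix n n ℍ[ℝ])ᴴ * J * (g : Matrix n n ℍ[ℝ]) = J := by
  refine ⟨fun h => h.2, fun h => ⟨?_, h⟩⟩
  obtain ⟨u, rfl⟩ := hJ
  have hu : reducedNorm (u : Matrix n n ℍ[ℝ]) ≠ 0 := by
    intro h0
    have e : reducedNorm ((u : Matrix n n ℍ[ℝ]) * ((u⁻¹ : (Matrix n n ℍ[ℝ])ˣ) : Matrix n n ℍ[ℝ])) =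
      1 := by rw [Units.mul_inv, reducedNorm_one]
    rw [reducedNorm_mul, h0, zero_mul] at e
    exact zero_ne_one e
  have e := congrArg reducedNorm h
  rw [reducedNorm_mul, reducedNorm_mul, reducedNorm_conjTranspose] at e
  have hg := reducedNorm_nonneg (g : Matrix n n ℍ[ℝ])
  rw [Complex.nonneg_iff] at hg
  obtain ⟨r, hr⟩ : ∃ r : ℝ, reducedNorm (g : Matrix n n ℍ[ℝ]) = r :=
    ⟨_, Complex.ext rfl hg.2.symm⟩
  rw [hr] at e hg ⊢
  have e2 : (r : ℂ) * r = 1 := by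
    refine mul_left_cancel₀ hu ?_
    rw [mul_one]
    nth_rw 2 [← e]
    simp
    ring
  have e3 : r * r = 1 := by exact_mod_cast e2
  have e4 : r = 1 := by
    rcases mul_self_eq_one_iff.1 e3 with h | h
    · exact h
    · have := hg.1
      simp [h] at this
      linarith
  simp [e4]

end reducedNorm

end QuatForm

/-! ### Hermitian and skew-Hermitian forms over the quaternions -/

namespace QuatForm

open MulOpposite

/-- The quaternion unit `i`. -/
noncomputable def unitI : ℍ[ℝ] := ⟨0, 1, 0, 0⟩

theorem re_unitI : unitI.re = 0 := rfl
theorem imI_unitI : unitI.imI = 1 := rfl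
theorem imJ_unitI : unitI.imJ = 0 := rfl
theorem imK_unitI : unitI.imK = 0 := rfl
theorem re_unitJ : unitJ.re = 0 := rfl
theorem imI_unitJ : unitJ.imI = 0 := rfl
theorem imJ_unitJ : unitJ.imJ = 1 := rfl
theorem imK_unitJ : unitJ.imK = 0 := rfl

theorem unitJ_mul_unitJ : unitJ * unitJ = -1 := by
  ext <;> simp [re_unitJ, imI_unitJ, imJ_unitJ, imK_unitJ]

theorem unitJ_mul_unitI : unitJ * unitI = -(unitI * unitJ) := by
  ext <;> simp [re_unitJ, imI_unitJ, imJ_unitJ, imK_unitJ, re_unitI, imI_unitI, imJ_unitI,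
    imK_unitI]

theorem unitI_ne_zero : unitI ≠ 0 := fun h => by
  simpa [imI_unitI] using congrArg QuaternionAlgebra.imI h

variable {W : Type*} [AddCommGroup W] [Module ℍ[ℝ]ᵐᵒᵖ W]

/-- A sesquilinear form on a right quaternionic vector space with `star (B v u) = ε • B u v`. -/
structure IsEpsHermitian (ε : ℝ) (B : W → W → ℍ[ℝ]) : Prop where
  add_right : ∀ v u w, B v (u + w) = B v u + B v w
  smul_right : ∀ (v u) (c : ℍ[ℝ]), B v (op c • u) = B v u * c
  star_eq : ∀ v u, star (B v u) = ε • B u v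
  eps : ε = 1 ∨ ε = -1

namespace IsEpsHermitian

variable {ε : ℝ} {B : W → W → ℍ[ℝ]}

theorem eq_star (h : IsEpsHermitian ε B) (v u : W) : B v u = ε • star (B u v) := by
  rw [h.star_eq, smul_smul]
  rcases h.eps with rfl | rfl <;> simp

theorem add_left (h : IsEpsHermitian ε B) (v u w : W) : B (v + u) w = B v w + B u w := by
  rw [h.eq_star, h.add_right, star_add, smul_add, ← h.eq_star, ← h.eq_star]

theorem smul_left (h : IsEpsHermitian ε B) (v u : W) (c : ℍ[ℝ]) :
    B (op c • v) u = star c * B v u := by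
  rw [h.eq_star, h.smul_right, star_mul, ← mul_smul_comm, ← h.eq_star]

theorem zero_right (h : IsEpsHermitian ε B) (v : W) : B v 0 = 0 := by
  have := h.smul_right v 0 0
  simpa using this

theorem sub_right (h : IsEpsHermitian ε B) (v u w : W) : B v (u - w) = B v u - B v w := by
  rw [eq_sub_iff_add_eq, ← h.add_right, sub_add_cancel]

theorem sum_right (h : IsEpsHermitian ε B) {ι : Type*} (s : Finset ι) (v : W) (f : ι → W) :
    B v (∑ i ∈ s, f i) = ∑ i ∈ s, B v (f i) :=
  map_sum (AddMonoidHom.mk' (B v) (h.add_right v)) f s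

theorem sum_left (h : IsEpsHermitian ε B) {ι : Type*} (s : Finset ι) (v : W) (f : ι → W) :
    B (∑ i ∈ s, f i) v = ∑ i ∈ s, B (f i) v :=
  map_sum (AddMonoidHom.mk' (fun u => B u v) fun u w => h.add_left u w v) f s

/-- Polarization. -/
theorem eq_zero_of_forall_self (h : IsEpsHermitian ε B) {S : Submodule ℍ[ℝ]ᵐᵒᵖ W}
    (hS : ∀ v ∈ S, B v v = 0) {v u : W} (hv : v ∈ S) (hu : u ∈ S) : B v u = 0 := by
  have h1 : ∀ u ∈ S, star (B v u) = -(ε • B v u) := fun u hu => by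
    have e := hS _ (S.add_mem hv hu)
    rw [h.add_left, h.add_right, h.add_right, hS v hv, hS u hu, zero_add, add_zero] at e
    rw [h.star_eq, eq_neg_of_add_eq_zero_right e, smul_neg]
  have h2 : ∀ c : ℍ[ℝ], star (B v u * c) = -(ε • (B v u * c)) := fun c => by
    have := h1 _ (S.smul_mem (op c) hu)
    rwa [h.smul_right] at this
  -- For every `c`, `B v u * c` is imaginary if `ε = 1` and real if `ε = -1`. The choices `star (B v
  -- u)` and `star (B v u) * i` give a real and an imaginary multiple of the squared norm, which
  -- must therefore vanish.
  rcases h.eps with rfl | rfl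
  · have e := h2 (star (B v u))
    rw [Quaternion.self_mul_star, Quaternion.star_coe, one_smul] at e
    have e' := congrArg QuaternionAlgebra.re e
    simp only [Quaternion.re_coe, Quaternion.re_neg] at e'
    exact Quaternion.normSq_eq_zero.1 (by linarith)
  · have e := h2 (star (B v u) * unitI)
    rw [← mul_assoc, Quaternion.self_mul_star] at e
    have e' := congrArg QuaternionAlgebra.imI e
    simp [imI_unitI] at e'
    exact Quaternion.normSq_eq_zero.1 (by simpa using (by linarith : Quaternion.normSq (B v u) = 0))

theorem linearIndependent (h : IsEpsHermitian ε B) {ι : Type*} [Fintype ι] [DecidableEq ι]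
    {e : ι → W} {s : ι → ℍ[ℝ]} (hs : ∀ i, s i ≠ 0)
    (he : ∀ i j, B (e i) (e j) = Matrix.diagonal s i j) : LinearIndependent ℍ[ℝ]ᵐᵒᵖ e := by
  rw [Fintype.linearIndependent_iff]
  intro c hc i
  have e1 := congrArg (B (e i)) hc
  rw [h.sum_right, h.zero_right, Finset.sum_eq_single i] at e1
  · rw [← op_unop (c i), h.smul_right, he, Matrix.diagonal_apply_eq] at e1
    exact unop_eq_zero_iff _ |>.1 ((mul_eq_zero.1 e1).resolve_left (hs i))
  · intro j _ hj
    rw [← op_unop (c j), h.smul_right, he, Matrix.diagonal_apply_ne _ hj.symm, zero_mul]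
  · simp

/-- An orthogonal basis with normalized values. -/
theorem exists_basis (h : IsEpsHermitian ε B) [FiniteDimensional ℍ[ℝ]ᵐᵒᵖ W]
    (hB : ∀ u, (∀ v, B v u = 0) → u = 0) (S : Set ℍ[ℝ]) (hS : ∀ s ∈ S, s ≠ 0)
    (hnorm : ∀ v, B v v ≠ 0 → ∃ c : ℍ[ℝ], star c * B v v * c ∈ S) :
    ∃ (m : ℕ) (e : Module.Basis (Fin m) ℍ[ℝ]ᵐᵒᵖ W) (s : Fin m → ℍ[ℝ]), (∀ i, s i ∈ S) ∧
      ∀ i j, B (e i) (e j) = Matrix.diagonal s i j := by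
  by_contra hcon
  -- Without such a basis, normalized orthogonal families could always be lengthened, past the
  -- dimension.
  have key : ∀ m : ℕ, ∃ (e : Fin m → W) (s : Fin m → ℍ[ℝ]), (∀ i, s i ∈ S) ∧
      ∀ i j, B (e i) (e j) = Matrix.diagonal s i j := by
    intro m
    induction m with
    | zero => exact ⟨Fin.elim0, Fin.elim0, fun i => i.elim0, fun i => i.elim0⟩
    | succ m ih =>
      obtain ⟨e, s, hs, he⟩ := ih
      have hs0 : ∀ i, s i ≠ 0 := fun i => hS _ (hs i)
      have hli := h.linearIndependent hs0 he
      let pr : W → W := fun v => ∑ i, op ((s i)⁻¹ * B (e i) v) • e i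
      have hpr : ∀ v i, B (e i) (v - pr v) = 0 := fun v i => by
        rw [h.sub_right, h.sum_right, Finset.sum_eq_single i]
        · rw [h.smul_right, he, Matrix.diagonal_apply_eq, mul_inv_cancel_left₀ (hs0 i), sub_self]
        · intro j _ hj
          rw [h.smul_right, he, Matrix.diagonal_apply_ne _ hj.symm, zero_mul]
        · simp
      let P : Submodule ℍ[ℝ]ᵐᵒᵖ W :=
        { carrier := {w | ∀ i, B (e i) w = 0}
          zero_mem' := fun i => h.zero_right _
          add_mem' := fun ha hb i => by rw [h.add_right, ha i, hb i, add_zero]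
          smul_mem' := fun c w hw i => by rw [← op_unop c, h.smul_right, hw i, zero_mul] }
      -- If all diagonal values on the complement `P` vanished, polarization would put `P` in the
      -- radical of `B`. Then every `v` equals its projection `pr v` and the family is a basis.
      obtain ⟨w, hw, hww⟩ : ∃ w ∈ P, B w w ≠ 0 := by
        by_contra! hP
        refine hcon ⟨m, Module.Basis.mk hli fun v _ => ?_, s, hs, fun i j => ?_⟩
        · have h0 : v - pr v = 0 := by
            refine hB _ fun u => ?_
            have hu : u = pr u + (u - pr u) := by abel
            rw [hu, h.add_left, h.eq_zero_of_forall_self hP (hpr u) (hpr v), add_zero, h.sum_left]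
            refine Finset.sum_eq_zero fun i _ => ?_
            rw [h.smul_left, hpr, mul_zero]
          rw [sub_eq_zero.1 h0]
          exact Submodule.sum_mem _ fun i _ =>
            Submodule.smul_mem _ _ (Submodule.subset_span ⟨i, rfl⟩)
        · rw [Module.Basis.mk_apply, Module.Basis.mk_apply, he]
      obtain ⟨c, hc⟩ := hnorm w hww
      have hw' : ∀ i, B w (e i) = 0 := fun i => by
        rw [h.eq_star, hw i, star_zero, smul_zero]
      refine ⟨Fin.cons (op c • w) e, Fin.cons (star c * B w w * c) s, fun i => ?_, fun i j => ?_⟩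
      · refine Fin.cases ?_ (fun i => ?_) i
        · exact hc
        · exact hs i
      · refine Fin.cases ?_ (fun i => ?_) i <;> refine Fin.cases ?_ (fun j => ?_) j
        · simp [h.smul_right, h.smul_left]
        · rw [Matrix.diagonal_apply_ne _ (Fin.succ_ne_zero j).symm]
          simp [h.smul_left, hw']
        · rw [Matrix.diagonal_apply_ne _ (Fin.succ_ne_zero i)]
          simp [h.smul_right, hw i]
        · simp [he, Matrix.diagonal_apply]
  obtain ⟨e, s, hs, he⟩ := key (Module.finrank ℍ[ℝ]ᵐᵒᵖ W + 1)
  have := (h.linearIndependent (fun i => hS _ (hs i)) he).fintype_card_le_finrank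
  simp at this

end IsEpsHermitian

theorem exists_star_mul_mul_eq_sign {a : ℍ[ℝ]} (ha : star a = a) (h0 : a ≠ 0) :
    ∃ c : ℍ[ℝ], star c * a * c ∈ ({1, -1} : Set ℍ[ℝ]) := by
  obtain ⟨r, rfl⟩ : ∃ r : ℝ, a = r := ⟨a.re, (Quaternion.star_eq_self.1 ha)⟩
  have hr : r ≠ 0 := fun h => h0 (by simp [h])
  have hs : (√|r|)⁻¹ * (√|r|)⁻¹ = |r|⁻¹ := by
    rw [← mul_inv, Real.mul_self_sqrt (abs_nonneg r)]
  have e : star (((√|r|)⁻¹ : ℝ) : ℍ[ℝ]) * r * (((√|r|)⁻¹ : ℝ) : ℍ[ℝ]) =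
      ((r * |r|⁻¹ : ℝ) : ℍ[ℝ]) := by
    rw [Quaternion.star_coe, ← Quaternion.coe_mul, ← Quaternion.coe_mul, mul_right_comm, hs,
      mul_comm]
  refine ⟨(((√|r|)⁻¹ : ℝ) : ℍ[ℝ]), ?_⟩
  rw [e]
  rcases lt_or_gt_of_ne hr with h | h
  · right
    rw [abs_of_neg h, Set.mem_singleton_iff, inv_neg, mul_neg, mul_inv_cancel₀ hr]
    simp
  · left
    rw [abs_of_pos h, mul_inv_cancel₀ hr]
    simp

/-- After scaling, `a` and `j` are both square roots of `-1`, hence conjugate. No sign survives, so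
a skew-Hermitian form has no signature. -/
theorem exists_star_mul_mul_eq_unitJ {a : ℍ[ℝ]} (ha : star a = -a) (h0 : a ≠ 0) :
    ∃ c : ℍ[ℝ], star c * a * c = unitJ := by
  set N : ℝ := √(Quaternion.normSq a) with hN
  have hNN : N * N = Quaternion.normSq a := Real.mul_self_sqrt Quaternion.normSq_nonneg
  have hN0 : N ≠ 0 := fun h => h0 (Quaternion.normSq_eq_zero.1 (by rw [← hNN, h, mul_zero]))
  have haa : a * a = -((N * N : ℝ) : ℍ[ℝ]) := by
    rw [hNN, ← Quaternion.self_mul_star, ha, mul_neg, neg_neg]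
  -- The intertwiner `N - a * j` works because `a * a = -N ^ 2`; it vanishes only for `a = -N * j`,
  -- where `i` does the job.
  obtain ⟨c, hc0, hc⟩ : ∃ c : ℍ[ℝ], c ≠ 0 ∧ a * c = N * (c * unitJ) := by
    by_cases h : a = -(N * unitJ)
    · refine ⟨unitI, unitI_ne_zero, ?_⟩
      rw [h, neg_mul, mul_assoc, unitJ_mul_unitI, mul_neg, neg_neg]
    · refine ⟨N - a * unitJ, fun h' => h ?_, ?_⟩
      · rw [sub_eq_zero] at h'
        rw [h', mul_assoc, unitJ_mul_unitJ]
        simp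
      · rw [mul_sub, ← mul_assoc, haa, sub_mul, mul_assoc a, unitJ_mul_unitJ, mul_sub,
          Quaternion.coe_mul, ← Quaternion.coe_commutes N a]
        simp only [neg_mul, mul_neg, mul_one, mul_assoc]
        abel
  have hM : 0 < N * Quaternion.normSq c := mul_pos
    (lt_of_le_of_ne (Real.sqrt_nonneg _) hN0.symm)
    (lt_of_le_of_ne Quaternion.normSq_nonneg (Quaternion.normSq_ne_zero.2 hc0).symm)
  set t : ℝ := (√(N * Quaternion.normSq c))⁻¹
  have ht : t * (t * (N * Quaternion.normSq c)) = 1 := by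
    rw [← mul_assoc, ← mul_inv, Real.mul_self_sqrt hM.le, inv_mul_cancel₀ hM.ne']
  refine ⟨c * t, ?_⟩
  rw [star_mul, Quaternion.star_coe, mul_assoc, mul_assoc, ← mul_assoc a, hc,
    ← Quaternion.coe_commutes t, ← mul_assoc (star c), ← Quaternion.coe_commutes t (star c),
    mul_assoc _ (star c), ← mul_assoc (star c) (N : ℍ[ℝ]), ← Quaternion.coe_commutes N (star c),
    mul_assoc (N : ℍ[ℝ]), ← mul_assoc (star c), Quaternion.star_mul_self]
  simp only [← mul_assoc, ← Quaternion.coe_mul]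
  rw [mul_assoc (t * t), mul_assoc t, ht]
  simp

end QuatForm

/-! ### Frames of lowest weight vectors in matrix form -/

namespace QuatForm

open SlTwo

section

variable {n : Type} [Fintype n] [DecidableEq n]

/-- A quaternionic matrix as a real-linear endomorphism of the column space. -/
noncomputable def mulVecEnd : Matrix n n ℍ[ℝ] →ₐ[ℝ] Module.End ℝ (n → ℍ[ℝ]) where
  toFun A :=
    { toFun := fun v => A *ᵥ v
      map_add' := A.mulVec_add
      map_smul' := fun r v => A.mulVec_smul r v }
  map_one' := LinearMap.ext fun v => Matrix.one_mulVec v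
  map_mul' A B := LinearMap.ext fun v => (Matrix.mulVec_mulVec v A B).symm
  map_zero' := LinearMap.ext fun v => Matrix.zero_mulVec v
  map_add' A B := LinearMap.ext fun v => Matrix.add_mulVec A B v
  commutes' r := LinearMap.ext fun v => by
    change algebraMap ℝ (Matrix n n ℍ[ℝ]) r *ᵥ v = r • v
    rw [Algebra.algebraMap_eq_smul_one, Matrix.smul_mulVec, Matrix.one_mulVec]

theorem mulVecEnd_apply (A : Matrix n n ℍ[ℝ]) (v : n → ℍ[ℝ]) : mulVecEnd A v = A *ᵥ v := rfl

theorem mulVecEnd_pow_apply (A : Matrix n n ℍ[ℝ]) (l : ℕ) (v : n → ℍ[ℝ]) :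
    (mulVecEnd A ^ l) v = (A ^ l) *ᵥ v := by
  rw [← map_pow, mulVecEnd_apply]

theorem mulVec_ext {m : Type} [Fintype m] [DecidableEq m] {l : Type} {A B : Matrix l m ℍ[ℝ]}
    (h : ∀ v, A *ᵥ v = B *ᵥ v) : A = B :=
  Matrix.ext_of_mulVec_single fun _ => h _

/-- The columns of `U` are lowest weight vectors of weight `-k`. -/
def LowestColumns (H Y : Matrix n n ℍ[ℝ]) {m : Type} [Fintype m] (U : Matrix n m ℍ[ℝ]) (k : ℕ) :
    Prop :=
  ∀ c, U *ᵥ c ∈ lowestWeight (mulVecEnd H) (mulVecEnd Y) k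

variable {J X H Y : Matrix n n ℍ[ℝ]} {m m' : Type}

theorem mul_pow_eq_conjTranspose_mul (hX : Xᴴ * J + J * X = 0) (U : Matrix n m ℍ[ℝ]) (l : ℕ) :
    Uᴴ * J * X ^ l = ((-X) ^ l * U)ᴴ * J := by
  have h : SemiconjBy J X (-X)ᴴ := by
    rw [SemiconjBy, Matrix.conjTranspose_neg, neg_mul, eq_neg_iff_add_eq_zero, add_comm, hX]
  have h' := h.pow_right l
  rw [SemiconjBy] at h'
  rw [Matrix.mul_assoc, h', Matrix.conjTranspose_mul, Matrix.conjTranspose_pow, Matrix.mul_assoc]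

omit [Fintype n] [DecidableEq n] in
theorem conjTranspose_real_smul (r : ℝ) (U : Matrix n m ℍ[ℝ]) : (r • U)ᴴ = r • Uᴴ :=
  Matrix.ext fun i j => Quaternion.star_smul r (U j i)

theorem conjTranspose_pow_mul_mul (hX : Xᴴ * J + J * X = 0) (l : ℕ) (U : Matrix n m ℍ[ℝ])
    (A : Matrix n m' ℍ[ℝ]) : (X ^ l * U)ᴴ * J * A = (-1 : ℝ) ^ l • (Uᴴ * J * (X ^ l * A)) := by
  have e := mul_pow_eq_conjTranspose_mul hX U l
  have e' : (-X) ^ l * U = (-1 : ℝ) ^ l • (X ^ l * U) := by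
    rw [← neg_one_smul ℝ X, smul_pow, Matrix.smul_mul]
  rw [e', conjTranspose_real_smul, Matrix.smul_mul] at e
  rw [← Matrix.mul_assoc _ (X ^ l), e, Matrix.smul_mul, smul_smul, ← mul_pow]
  simp

namespace LowestColumns

variable [Fintype m] [Fintype m'] [DecidableEq m] [DecidableEq m']

theorem y_mul {U : Matrix n m ℍ[ℝ]} {k : ℕ} (hU : LowestColumns H Y U k) : Y * U = 0 :=
  mulVec_ext fun v => by
    rw [← Matrix.mulVec_mulVec, Matrix.zero_mulVec]
    exact (mem_lowestWeight.1 (hU v)).1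

theorem h_pow_mul (h : Relations (mulVecEnd X) (mulVecEnd H) (mulVecEnd Y)) {U : Matrix n m ℍ[ℝ]}
    {k : ℕ} (hU : LowestColumns H Y U k) (l : ℕ) :
    H * (X ^ l * U) = (2 * l - k : ℝ) • (X ^ l * U) :=
  mulVec_ext fun v => by
    have e := h.h_pow_x_lowestWeight (hU v) l
    rw [mulVecEnd_pow_apply] at e
    rw [← Matrix.mulVec_mulVec, Matrix.smul_mulVec, ← Matrix.mulVec_mulVec]
    exact e

theorem h_mul {U : Matrix n m ℍ[ℝ]}
    {k : ℕ} (hU : LowestColumns H Y U k) : H * U = (-k : ℝ) • U :=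
  mulVec_ext fun v => by
    rw [← Matrix.mulVec_mulVec, Matrix.smul_mulVec]
    exact (mem_lowestWeight.1 (hU v)).2

theorem y_pow_mul (h : Relations (mulVecEnd X) (mulVecEnd H) (mulVecEnd Y)) {U : Matrix n m ℍ[ℝ]}
    {k : ℕ} (hU : LowestColumns H Y U k) (l : ℕ) :
    Y * (X ^ (l + 1) * U) = ((l + 1) * (k - l) : ℝ) • (X ^ l * U) :=
  mulVec_ext fun v => by
    have e := h.y_pow_x_lowestWeight (hU v) l
    rw [mulVecEnd_pow_apply, mulVecEnd_pow_apply] at e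
    rw [← Matrix.mulVec_mulVec, Matrix.smul_mulVec, ← Matrix.mulVec_mulVec,
      ← Matrix.mulVec_mulVec]
    exact e

theorem pow_mul_eq_zero (h : Relations (mulVecEnd X) (mulVecEnd H) (mulVecEnd Y))
    {U : Matrix n m ℍ[ℝ]} {k : ℕ} (hU : LowestColumns H Y U k) {l : ℕ} (hl : k < l) :
    X ^ l * U = 0 :=
  mulVec_ext fun v => by
    have e := h.pow_x_eq_zero (hU v) hl
    rwa [mulVecEnd_pow_apply, Matrix.mulVec_mulVec, ← Matrix.zero_mulVec v] at e

/-- Orthogonality relations between the vectors `X ^ l v`. -/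
theorem conjTranspose_mul_mul_eq_zero (h : Relations (mulVecEnd X) (mulVecEnd H) (mulVecEnd Y))
    (hX : Xᴴ * J + J * X = 0) (hH : Hᴴ * J + J * H = 0) {U : Matrix n m ℍ[ℝ]}
    {U' : Matrix n m' ℍ[ℝ]} {k k' l : ℕ} (hU : LowestColumns H Y U k)
    (hU' : LowestColumns H Y U' k') (hl : ¬(k = l ∧ k' = l)) :
    Uᴴ * J * (X ^ l * U') = 0 := by
  rcases Nat.lt_or_ge k l with h1 | h1
  · rw [← Matrix.mul_assoc, mul_pow_eq_conjTranspose_mul hX, neg_pow, Matrix.mul_assoc ((-1) ^ l),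
      hU.pow_mul_eq_zero h h1]
    simp
  rcases Nat.lt_or_ge k' l with h2 | h2
  · rw [hU'.pow_mul_eq_zero h h2, Matrix.mul_zero]
  -- Here `l ≤ k` and `l ≤ k'`. Skewness of `H` lets it act on either side; a nonzero product would
  -- give `2 * l = k + k'`, hence `k = k' = l`.
  have e1 : Uᴴ * J * (H * (X ^ l * U')) = (2 * l - k' : ℝ) • (Uᴴ * J * (X ^ l * U')) := by
    rw [hU'.h_pow_mul h, Matrix.mul_smul]
  have e2 : Uᴴ * J * (H * (X ^ l * U')) = (k : ℝ) • (Uᴴ * J * (X ^ l * U')) := by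
    have e3 := mul_pow_eq_conjTranspose_mul hH U 1
    rw [pow_one, pow_one, Matrix.neg_mul, hU.h_mul, ← neg_smul, neg_neg,
      conjTranspose_real_smul] at e3
    rw [← Matrix.mul_assoc, e3]
    simp [Matrix.smul_mul]
  rw [e1, ← sub_eq_zero, ← sub_smul, smul_eq_zero] at e2
  refine e2.resolve_left fun h0 => hl ?_
  have : ((2 * l : ℕ) : ℝ) = ((k + k' : ℕ) : ℝ) := by
    push_cast
    linarith
  have := Nat.cast_injective this
  omega

end LowestColumns

end

/-- A family of quaternionic bases, with invertible Gram matrices, of all the nonzero spaces of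
lowest weight vectors of an `sl₂`-triple. -/
structure LowestFrame {n : Type} [Fintype n] [DecidableEq n] (J X H Y : Matrix n n ℍ[ℝ])
    {D : Type} (k : D → ℕ) (ι : D → Type) [∀ d, Fintype (ι d)] [∀ d, DecidableEq (ι d)] where
  rel : Relations (mulVecEnd X) (mulVecEnd H) (mulVecEnd Y)
  skew_x : Xᴴ * J + J * X = 0
  skew_h : Hᴴ * J + J * H = 0
  isUnit_form : IsUnit J
  k_injective : Function.Injective k
  basis : ∀ d, Matrix n (ι d) ℍ[ℝ]
  gram : ∀ d, (Matrix (ι d) (ι d) ℍ[ℝ])ˣ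
  lowest_basis : ∀ d, LowestColumns H Y (basis d) (k d)
  exists_of_mem : ∀ i, ∀ v ∈ lowestWeight (mulVecEnd H) (mulVecEnd Y) i, v ≠ 0 →
    ∃ d, k d = i ∧ ∃ c, v = basis d *ᵥ c
  gram_eq : ∀ d, (basis d)ᴴ * J * (X ^ k d * basis d) = gram d

namespace LowestFrame

variable {n : Type} [Fintype n] [DecidableEq n] {J X H Y : Matrix n n ℍ[ℝ]} {D : Type}
  {k : D → ℕ} {ι : D → Type} [∀ d, Fintype (ι d)] [∀ d, DecidableEq (ι d)]
  (F : LowestFrame J X H Y k ι)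

/-- The dual vectors of `X ^ l * basis d`. -/
noncomputable def dual (d : D) (l : ℕ) : Matrix (ι d) n ℍ[ℝ] :=
  (((F.gram d)⁻¹ : (Matrix (ι d) (ι d) ℍ[ℝ])ˣ) : Matrix (ι d) (ι d) ℍ[ℝ]) *
    ((F.basis d)ᴴ * J * X ^ (k d - l))

theorem dual_mul_of_ne {m : Type} [Fintype m] [DecidableEq m] {U : Matrix n m ℍ[ℝ]} {i : ℕ}
    (hU : LowestColumns H Y U i) {d : D} {l l' : ℕ} (hl : l ≤ k d) (h : ¬(k d = i ∧ l = l')) :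
    F.dual d l * (X ^ l' * U) = 0 := by
  rw [dual, Matrix.mul_assoc, Matrix.mul_assoc _ (X ^ (k d - l)), ← Matrix.mul_assoc (X ^ _),
    ← pow_add, (F.lowest_basis d).conjTranspose_mul_mul_eq_zero F.rel F.skew_x F.skew_h hU
    (fun h' => h (by omega)), Matrix.mul_zero]

theorem dual_mul_self {d : D} {l : ℕ} (hl : l ≤ k d) :
    F.dual d l * (X ^ l * F.basis d) = 1 := by
  rw [dual, Matrix.mul_assoc, Matrix.mul_assoc _ (X ^ (k d - l)), ← Matrix.mul_assoc (X ^ _),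
    ← pow_add, Nat.sub_add_cancel hl, F.gram_eq, Units.inv_mul]

/-- The columns of the `X ^ l * basis d` span the whole space, by `eq_top_of_forall_mem`. -/
theorem ext_mul {m : Type} {A B : Matrix m n ℍ[ℝ]}
    (h : ∀ d l, A * (X ^ l * F.basis d) = B * (X ^ l * F.basis d)) : A = B := by
  let S : Submodule ℝ (n → ℍ[ℝ]) :=
    { carrier := {v | A *ᵥ v = B *ᵥ v}
      zero_mem' := by simp
      add_mem' := fun {v w} hv hw => by
        rw [Set.mem_ofPred_eq] at hv hw ⊢
        rw [Matrix.mulVec_add, Matrix.mulVec_add, hv, hw]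
      smul_mem' := fun r v hv => by
        rw [Set.mem_ofPred_eq] at hv ⊢
        rw [Matrix.mulVec_smul, Matrix.mulVec_smul, hv] }
  have hS : S = ⊤ := F.rel.eq_top_of_forall_mem fun i l v hv => by
    by_cases hv0 : v = 0
    · rw [hv0, map_zero]
      exact S.zero_mem
    obtain ⟨d, rfl, c, rfl⟩ := F.exists_of_mem i v hv hv0
    have e := congrArg (fun M => M *ᵥ c) (h d l)
    simp only [← Matrix.mulVec_mulVec] at e
    rw [mulVecEnd_pow_apply]
    exact e
  refine mulVec_ext fun v => ?_
  have hv : v ∈ S := hS ▸ Submodule.mem_top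
  exact hv

theorem ext_conjTranspose_mul_mul {A B : Matrix n n ℍ[ℝ]}
    (h : ∀ d l d' l', (X ^ l * F.basis d)ᴴ * A * (X ^ l' * F.basis d') =
      (X ^ l * F.basis d)ᴴ * B * (X ^ l' * F.basis d')) : A = B := by
  refine F.ext_mul fun d' l' => Matrix.conjTranspose_injective (F.ext_mul fun d l => ?_)
  apply Matrix.conjTranspose_injective
  simpa only [Matrix.conjTranspose_mul, Matrix.conjTranspose_conjTranspose,
    ← Matrix.mul_assoc] using h d l d' l'

/-- The endomorphism that acts on `X ^ l * basis d` through the matrix `M d`. -/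
noncomputable def assemble [Fintype D] (M : ∀ d, Matrix (ι d) (ι d) ℍ[ℝ]) : Matrix n n ℍ[ℝ] :=
  ∑ d, ∑ l ∈ Finset.range (k d + 1), X ^ l * F.basis d * M d * F.dual d l

theorem assemble_mul [Fintype D] (M : ∀ d, Matrix (ι d) (ι d) ℍ[ℝ]) (d : D) (l : ℕ) :
    F.assemble M * (X ^ l * F.basis d) = X ^ l * F.basis d * M d := by
  rcases Nat.lt_or_ge (k d) l with hl | hl
  · rw [(F.lowest_basis d).pow_mul_eq_zero F.rel hl, Matrix.mul_zero, Matrix.zero_mul]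
  rw [assemble, Matrix.sum_mul, Finset.sum_eq_single d]
  · rw [Matrix.sum_mul, Finset.sum_eq_single l]
    · rw [Matrix.mul_assoc, F.dual_mul_self hl, Matrix.mul_one]
    · intro i hi hil
      rw [Matrix.mul_assoc, F.dual_mul_of_ne (F.lowest_basis d)
        (Nat.lt_succ_iff.1 (Finset.mem_range.1 hi)) (fun h => hil h.2), Matrix.mul_zero]
    · intro h
      exact absurd (Finset.mem_range.2 (Nat.lt_succ_of_le hl)) h
  · intro d' _ hd
    rw [Matrix.sum_mul]
    refine Finset.sum_eq_zero fun i hi => ?_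
    rw [Matrix.mul_assoc, F.dual_mul_of_ne (F.lowest_basis d)
      (Nat.lt_succ_iff.1 (Finset.mem_range.1 hi)) (fun h => hd (F.k_injective h.1)),
      Matrix.mul_zero]
  · simp

/-- Resolution of the identity: `X ^ l * basis d` and `dual d l` are dual to each other. -/
theorem assemble_one [Fintype D] : F.assemble (fun _ => 1) = 1 :=
  F.ext_mul fun d l => by rw [F.assemble_mul, Matrix.mul_one, Matrix.one_mul]

theorem assemble_mul_assemble [Fintype D] (M N : ∀ d, Matrix (ι d) (ι d) ℍ[ℝ]) :
    F.assemble M * F.assemble N = F.assemble (fun d => M d * N d) :=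
  F.ext_mul fun d l => by
    rw [Matrix.mul_assoc, F.assemble_mul, ← Matrix.mul_assoc, F.assemble_mul, F.assemble_mul,
      Matrix.mul_assoc]

theorem dual_mul_assemble_mul [Fintype D] (M : ∀ d, Matrix (ι d) (ι d) ℍ[ℝ]) (d : D) :
    F.dual d 0 * F.assemble M * F.basis d = M d := by
  have e := F.assemble_mul M d 0
  have e' := F.dual_mul_self (d := d) (Nat.zero_le _)
  rw [pow_zero, Matrix.one_mul] at e e'
  rw [Matrix.mul_assoc, e, ← Matrix.mul_assoc, e', Matrix.one_mul]

theorem assemble_commute [Fintype D] (M : ∀ d, Matrix (ι d) (ι d) ℍ[ℝ]) {Z : Matrix n n ℍ[ℝ]}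
    (hZ : Z ∈ ({X, H, Y} : Set (Matrix n n ℍ[ℝ]))) : F.assemble M * Z = Z * F.assemble M := by
  -- Each of `X`, `H`, `Y` sends a block to a real multiple of a block with the same `d`, and real
  -- scalars commute with `M d`.
  have hc : ∀ d l, ∃ (c : ℝ) (l' : ℕ),
      Z * (X ^ l * F.basis d) = c • (X ^ l' * F.basis d) := by
    intro d l
    rcases hZ with rfl | rfl | rfl
    · exact ⟨1, l + 1, by rw [one_smul, pow_succ', Matrix.mul_assoc]⟩
    · exact ⟨_, l, (F.lowest_basis d).h_pow_mul F.rel l⟩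
    · rcases l with _ | l
      · exact ⟨0, 0, by rw [pow_zero, Matrix.one_mul, (F.lowest_basis d).y_mul, zero_smul]⟩
      · exact ⟨_, l, (F.lowest_basis d).y_pow_mul F.rel l⟩
  refine F.ext_mul fun d l => ?_
  obtain ⟨c, l', h⟩ := hc d l
  rw [Matrix.mul_assoc, h, Matrix.mul_smul, F.assemble_mul, Matrix.mul_assoc Z, F.assemble_mul,
    ← Matrix.mul_assoc, h, Matrix.smul_mul]

theorem assemble_isometry [Fintype D] (M : ∀ d, Matrix (ι d) (ι d) ℍ[ℝ])
    (hM : ∀ d, (M d)ᴴ * F.gram d * M d = F.gram d) :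
    (F.assemble M)ᴴ * J * F.assemble M = J := by
  refine F.ext_conjTranspose_mul_mul fun d l d' l' => ?_
  have e : (X ^ l * F.basis d)ᴴ * ((F.assemble M)ᴴ * J * F.assemble M) * (X ^ l' * F.basis d') =
      (M d)ᴴ * ((X ^ l * F.basis d)ᴴ * J * (X ^ l' * F.basis d')) * M d' := by
    rw [Matrix.mul_assoc _ _ (X ^ l' * F.basis d'), Matrix.mul_assoc _ (F.assemble M),
      F.assemble_mul, Matrix.mul_assoc _ J, ← Matrix.mul_assoc _ ((F.assemble M)ᴴ),
      ← Matrix.conjTranspose_mul, F.assemble_mul, Matrix.conjTranspose_mul]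
    simp only [Matrix.mul_assoc]
  rw [e, conjTranspose_pow_mul_mul F.skew_x, ← Matrix.mul_assoc (X ^ l), ← pow_add]
  by_cases h : k d = l + l' ∧ k d' = l + l'
  · obtain rfl : d = d' := F.k_injective (h.1.trans h.2.symm)
    rw [← h.1, F.gram_eq, Matrix.mul_smul, Matrix.smul_mul, hM]
  · rw [(F.lowest_basis d).conjTranspose_mul_mul_eq_zero F.rel F.skew_x F.skew_h
      (F.lowest_basis d') h]
    simp

/-- Since `g` commutes with `H` and `Y`, it preserves lowest weight vectors of a given weight. In
the resolution of the identity only the term with the same `d` and `l = 0` survives. -/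
theorem mul_basis_eq [Fintype D] {g : Matrix n n ℍ[ℝ]} (hH : g * H = H * g) (hY : g * Y = Y * g)
    (d : D) : g * F.basis d = F.basis d * (F.dual d 0 * g * F.basis d) := by
  have hg : LowestColumns H Y (g * F.basis d) (k d) := fun c => by
    obtain ⟨h1, h2⟩ := mem_lowestWeight.1 (F.lowest_basis d c)
    rw [mulVecEnd_apply] at h1 h2
    have e1 : Y *ᵥ ((g * F.basis d) *ᵥ c) = g *ᵥ (Y *ᵥ (F.basis d *ᵥ c)) := by
      simp only [Matrix.mulVec_mulVec, ← Matrix.mul_assoc, hY]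
    have e2 : H *ᵥ ((g * F.basis d) *ᵥ c) = g *ᵥ (H *ᵥ (F.basis d *ᵥ c)) := by
      simp only [Matrix.mulVec_mulVec, ← Matrix.mul_assoc, hH]
    rw [mem_lowestWeight, mulVecEnd_apply, mulVecEnd_apply, e1, e2, h1, h2, Matrix.mulVec_zero,
      Matrix.mulVec_smul, Matrix.mulVec_mulVec]
    exact ⟨rfl, rfl⟩
  have e : g * F.basis d = F.assemble (fun _ => 1) * (X ^ 0 * (g * F.basis d)) := by
    rw [F.assemble_one, pow_zero, Matrix.one_mul, Matrix.one_mul]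
  have hne : ∀ d' l, l ≤ k d' → ¬(d' = d ∧ l = 0) →
      F.dual d' l * (X ^ 0 * (g * F.basis d)) = 0 := fun d' l hl h =>
    F.dual_mul_of_ne hg hl fun h' => h ⟨F.k_injective h'.1, h'.2⟩
  rw [e, assemble, Matrix.sum_mul, Finset.sum_eq_single d]
  · rw [Matrix.sum_mul, Finset.sum_eq_single 0]
    · simp only [pow_zero, Matrix.one_mul, Matrix.mul_one, Matrix.mul_assoc]
    · intro l hl h
      rw [Matrix.mul_assoc, hne d l (Nat.lt_succ_iff.1 (Finset.mem_range.1 hl)) (fun h' => h h'.2),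
        Matrix.mul_zero]
    · simp
  · intro d' _ hd
    rw [Matrix.sum_mul]
    refine Finset.sum_eq_zero fun l hl => ?_
    rw [Matrix.mul_assoc, hne d' l (Nat.lt_succ_iff.1 (Finset.mem_range.1 hl)) (fun h' => hd h'.1),
      Matrix.mul_zero]
  · simp

theorem mul_pow_basis_eq [Fintype D] {g : Matrix n n ℍ[ℝ]} (hX : g * X = X * g)
    (hH : g * H = H * g) (hY : g * Y = Y * g) (d : D) (l : ℕ) :
    g * (X ^ l * F.basis d) = X ^ l * F.basis d * (F.dual d 0 * g * F.basis d) := by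
  have hXl : g * X ^ l = X ^ l * g := (Commute.pow_right hX l).eq
  rw [← Matrix.mul_assoc, hXl, Matrix.mul_assoc, F.mul_basis_eq hH hY,
    ← Matrix.mul_assoc (X ^ l)]

theorem assemble_dual_mul [Fintype D] {g : Matrix n n ℍ[ℝ]} (hX : g * X = X * g)
    (hH : g * H = H * g) (hY : g * Y = Y * g) :
    F.assemble (fun d => F.dual d 0 * g * F.basis d) = g :=
  F.ext_mul fun d l => by rw [F.assemble_mul, F.mul_pow_basis_eq hX hH hY]

theorem gram_isometry [Fintype D] {g : Matrix n n ℍ[ℝ]} (hX : g * X = X * g)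
    (hH : g * H = H * g) (hY : g * Y = Y * g) (hg : gᴴ * J * g = J) (d : D) :
    (F.dual d 0 * g * F.basis d)ᴴ * (F.gram d).val * (F.dual d 0 * g * F.basis d) =
      (F.gram d).val := by
  have e1 := F.mul_basis_eq hH hY d
  have e2 := F.mul_pow_basis_eq hX hH hY d (k d)
  rw [← F.gram_eq]
  set M := F.dual d 0 * g * F.basis d
  calc Mᴴ * ((F.basis d)ᴴ * J * (X ^ k d * F.basis d)) * M
      = (F.basis d * M)ᴴ * J * (X ^ k d * F.basis d * M) := by
        simp only [Matrix.conjTranspose_mul, Matrix.mul_assoc]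
    _ = (F.basis d)ᴴ * (gᴴ * J * g) * (X ^ k d * F.basis d) := by
        rw [← e1, ← e2]
        simp only [Matrix.conjTranspose_mul, Matrix.mul_assoc]
    _ = (F.basis d)ᴴ * J * (X ^ k d * F.basis d) := by rw [hg]

end LowestFrame
end QuatForm

/-! ### The centralizer as a product of isometry groups -/

namespace QuatForm

open SlTwo

namespace LowestFrame

variable {n : Type} [Fintype n] [DecidableEq n] {J X H Y : Matrix n n ℍ[ℝ]} {D : Type}
  {k : D → ℕ} {ι : D → Type} [∀ d, Fintype (ι d)] [∀ d, DecidableEq (ι d)]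
  (F : LowestFrame J X H Y k ι) [Fintype D]

/-- A family of isometries of the Gram matrices assembled to an element of the centralizer. -/
noncomputable def assembleHom :
    (∀ d, formGroup (F.gram d).val) →* adCentralizer (formGroup J) {X, H, Y} where
  toFun M :=
    ⟨{ val := F.assemble fun d => (M d).1.val
       inv := F.assemble fun d => (M d).1⁻¹.val
       val_inv := by simp [F.assemble_mul_assemble, F.assemble_one]
       inv_val := by simp [F.assemble_mul_assemble, F.assemble_one] },
      (mem_formGroup_iff F.isUnit_form _).2 (F.assemble_isometry _ fun d => (M d).2.2),
      fun Z hZ => by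
        rw [Units.mul_inv_eq_iff_eq_mul]
        exact F.assemble_commute _ hZ⟩
  map_one' := by
    ext1
    ext1
    exact F.assemble_one
  map_mul' M N := by
    ext1
    ext1
    exact (F.assemble_mul_assemble _ _).symm

theorem assembleHom_val (M : ∀ d, formGroup (F.gram d).val) :
    (F.assembleHom M).1.val = F.assemble fun d => (M d).1.val := rfl

theorem dual_mul_assembleHom_mul (M : ∀ d, formGroup (F.gram d).val) (d : D) :
    F.dual d 0 * (F.assembleHom M).1.val * F.basis d = (M d).1.val :=
  F.dual_mul_assemble_mul _ d

theorem assembleHom_injective : Function.Injective F.assembleHom := fun M N h => by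
  ext1 d
  ext1
  ext1
  rw [← F.dual_mul_assembleHom_mul, h, F.dual_mul_assembleHom_mul]

theorem assembleHom_surjective : Function.Surjective F.assembleHom := by
  have hcomm : ∀ g ∈ adCentralizer (formGroup J) {X, H, Y},
      g.val * X = X * g.val ∧ g.val * H = H * g.val ∧ g.val * Y = Y * g.val := fun g hg =>
    ⟨(Units.mul_inv_eq_iff_eq_mul _).1 (hg.2 X (by simp)),
      (Units.mul_inv_eq_iff_eq_mul _).1 (hg.2 H (by simp)),
      (Units.mul_inv_eq_iff_eq_mul _).1 (hg.2 Y (by simp))⟩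
  have hmul : ∀ g h : (Matrix n n ℍ[ℝ])ˣ, g * h = 1 →
      h ∈ adCentralizer (formGroup J) {X, H, Y} → ∀ d,
      (F.dual d 0 * g.val * F.basis d) * (F.dual d 0 * h.val * F.basis d) = 1 := by
    intro g h hgh hh d
    have e := F.dual_mul_self (d := d) (Nat.zero_le _)
    rw [pow_zero, Matrix.one_mul] at e
    rw [Matrix.mul_assoc _ (F.basis d), ← F.mul_basis_eq (hcomm h hh).2.1 (hcomm h hh).2.2,
      ← Matrix.mul_assoc, Matrix.mul_assoc _ g.val, ← Units.val_mul, hgh, Units.val_one,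
      Matrix.mul_one, e]
  intro g
  obtain ⟨h1, h2, h3⟩ := hcomm g.1 g.2
  refine ⟨fun d => ⟨⟨F.dual d 0 * g.1.val * F.basis d, F.dual d 0 * g.1⁻¹.val * F.basis d,
    hmul _ _ (mul_inv_cancel g.1) (inv_mem g.2) d, hmul _ _ (inv_mul_cancel g.1) g.2 d⟩, ?_⟩, ?_⟩
  · exact (mem_formGroup_iff (F.gram d).isUnit _).2
      (F.gram_isometry h1 h2 h3 ((mem_formGroup_iff F.isUnit_form _).1 g.2.1) d)
  · ext1
    ext1
    exact F.assemble_dual_mul h1 h2 h3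

theorem continuous_assembleHom : Continuous F.assembleHom := by
  have hc : Continuous fun M : (∀ d, formGroup (F.gram d).val) => (F.assembleHom M).1.val := by
    simp only [assembleHom_val, assemble]
    refine continuous_finsetSum _ fun d _ => continuous_finsetSum _ fun l _ => ?_
    refine Continuous.matrix_mul (Continuous.matrix_mul continuous_const ?_) continuous_const
    exact Units.continuous_val.comp (continuous_subtype_val.comp (continuous_apply d))
  refine Continuous.subtype_mk (Units.continuous_iff.2 ⟨hc, ?_⟩) _
  -- The topology on units also asks for a continuous inverse, which is the value at the inverse
  -- family.
  have := hc.comp (continuous_inv (G := ∀ d, formGroup (F.gram d).val))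
  convert this using 2 with M
  rw [Function.comp_apply, map_inv]
  rfl

/-- The centralizer is the product of the isometry groups of the Gram matrices. -/
noncomputable def centralizerEquiv :
    adCentralizer (formGroup J) {X, H, Y} ≃ₜ* ∀ d, formGroup (F.gram d).val :=
  ContinuousMulEquiv.symm
    { MulEquiv.ofBijective F.assembleHom ⟨F.assembleHom_injective, F.assembleHom_surjective⟩ with
      continuous_toFun := F.continuous_assembleHom
      continuous_invFun := by
        set e := MulEquiv.ofBijective F.assembleHom
          ⟨F.assembleHom_injective, F.assembleHom_surjective⟩
        -- The inverse map is restriction to the lowest weight spaces, visibly continuous in `g`.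
        have hval : ∀ g d, (e.symm g d).1.val = F.dual d 0 * g.1.val * F.basis d := fun g d => by
          obtain ⟨M, rfl⟩ := e.surjective g
          rw [e.symm_apply_apply]
          exact (F.dual_mul_assembleHom_mul M d).symm
        have hc : ∀ d, Continuous fun g => (e.symm g d).1.val := fun d => by
          simp only [hval]
          exact Continuous.matrix_mul (Continuous.matrix_mul continuous_const
            (Units.continuous_val.comp continuous_subtype_val)) continuous_const
        refine continuous_pi fun d => Continuous.subtype_mk (Units.continuous_iff.2 ⟨hc d, ?_⟩) _
        have := (hc d).comp (continuous_inv (G := adCentralizer (formGroup J) {X, H, Y}))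
        convert this using 2 with g
        rw [Function.comp_apply, map_inv]
        rfl }

end LowestFrame
end QuatForm

/-! ### The forms on the lowest weight spaces -/

namespace QuatForm

open SlTwo MulOpposite

instance finite_quaternion_op : Module.Finite ℍ[ℝ]ᵐᵒᵖ ℍ[ℝ] :=
  Module.Finite.of_surjective (LinearMap.toSpanSingleton ℍ[ℝ]ᵐᵒᵖ ℍ[ℝ] 1)
    fun q => ⟨op q, one_mul q⟩

section

variable {n : Type} [Fintype n] [DecidableEq n] {J X H Y : Matrix n n ℍ[ℝ]}

theorem mem_dims_iff (h : Relations (mulVecEnd X) (mulVecEnd H) (mulVecEnd Y)) {d : ℕ} :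
    d ∈ dims X H Y ↔ ∃ k, d = k + 1 ∧ lowestWeight (mulVecEnd H) (mulVecEnd Y) k ≠ ⊥ :=
  h.exists_irreducible_finrank_iff d

/-- The case `d = 0` is excluded because `d - 1` truncates: `lowest X H Y 0` is zero, while weight
`0` may occur. -/
theorem mem_lowest_iff (h : Relations (mulVecEnd X) (mulVecEnd H) (mulVecEnd Y)) {d : ℕ}
    (hd : d ≠ 0) {v : n → ℍ[ℝ]} :
    v ∈ lowest X H Y d ↔ v ∈ lowestWeight (mulVecEnd H) (mulVecEnd Y) (d - 1) := by
  obtain ⟨k, rfl⟩ := Nat.exists_eq_succ_of_ne_zero hd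
  exact h.mem_sSup_irreducible_and_ker_iff k v

omit [DecidableEq n] in
theorem finite_dims : (dims X H Y).Finite :=
  (Set.finite_Iic (Module.finrank ℝ (n → ℍ[ℝ]))).subset fun _ ⟨A, _, hA⟩ =>
    hA ▸ Submodule.finrank_le A

/-- The matrix whose columns are the members of a family of vectors. -/
def columns {m : Type} (e : m → n → ℍ[ℝ]) : Matrix n m ℍ[ℝ] :=
  Matrix.of fun i a => e a i

omit [Fintype n] [DecidableEq n] in
theorem columns_mulVec {m : Type} [Fintype m] (e : m → n → ℍ[ℝ]) (c : m → ℍ[ℝ]) :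
    columns e *ᵥ c = ∑ a, op (c a) • e a := by
  ext1 i
  simp [columns, Matrix.mulVec, dotProduct]

omit [DecidableEq n] in
theorem conjTranspose_columns_mul {m m' : Type} (e : m → n → ℍ[ℝ]) (e' : m' → n → ℍ[ℝ])
    (A : Matrix n n ℍ[ℝ]) (a : m) (b : m') :
    ((columns e)ᴴ * J * (A * columns e')) a b = star (e a) ⬝ᵥ (J *ᵥ (A *ᵥ e' b)) := by
  rw [Matrix.mul_assoc]
  rfl

theorem lowestColumns_columns (h : Relations (mulVecEnd X) (mulVecEnd H) (mulVecEnd Y)) {d : ℕ}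
    (hd : d ≠ 0) {m : Type} [Fintype m] {e : m → n → ℍ[ℝ]} (he : ∀ a, e a ∈ lowest X H Y d) :
    LowestColumns H Y (columns e) (d - 1) := fun c => by
  rw [← mem_lowest_iff h hd, columns_mulVec]
  exact Submodule.sum_mem _ fun a _ => Submodule.smul_mem _ _ (he a)

/-- A quaternionic basis of `lowest X H Y d` with an invertible Gram matrix. -/
structure GramBasis (J X H Y : Matrix n n ℍ[ℝ]) (d : ℕ) where
  index : Type
  fintype : Fintype index
  decidableEq : DecidableEq index
  basis : Module.Basis index ℍ[ℝ]ᵐᵒᵖ (lowest X H Y d)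
  gram : (Matrix index index ℍ[ℝ])ˣ
  gram_eq : ∀ i j, inducedForm J X d (basis i) (basis j) = gram.val i j

attribute [instance] GramBasis.fintype GramBasis.decidableEq

/-- The frame given by bases of the spaces `lowest X H Y d` with invertible Gram matrices. -/
noncomputable def LowestFrame.ofBases
    (h : Relations (mulVecEnd X) (mulVecEnd H) (mulVecEnd Y))
    (skew_x : Xᴴ * J + J * X = 0) (skew_h : Hᴴ * J + J * H = 0) (hJ : IsUnit J)
    {D : Type} {w : D → ℕ} (hw : Function.Injective w) (hdims : Set.range w = dims X H Y)
    (b : ∀ d, GramBasis J X H Y (w d)) :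
    LowestFrame J X H Y (fun d => w d - 1) fun d => (b d).index :=
  have hw0 : ∀ d, w d ≠ 0 := fun d => by
    obtain ⟨k, hk, -⟩ := (mem_dims_iff h).1 (hdims ▸ Set.mem_range_self d)
    omega
  { rel := h
    skew_x := skew_x
    skew_h := skew_h
    isUnit_form := hJ
    k_injective := fun a a' hab => hw (by
      have := hw0 a
      have := hw0 a'
      dsimp only at hab
      omega)
    basis := fun d => columns fun i => ((b d).basis i : n → ℍ[ℝ])
    gram := fun d => (b d).gram
    lowest_basis := fun d => lowestColumns_columns h (hw0 d) fun i => ((b d).basis i).2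
    exists_of_mem := fun i v hv hv0 => by
      have hi : i + 1 ∈ Set.range w := by
        rw [hdims, mem_dims_iff h]
        exact ⟨i, rfl, (Submodule.ne_bot_iff _).2 ⟨v, hv, hv0⟩⟩
      obtain ⟨d, hd⟩ := hi
      have hdi : w d - 1 = i := by omega
      refine ⟨d, hdi,
        fun a => unop ((b d).basis.repr ⟨v, (mem_lowest_iff h (hw0 d)).2 (hdi ▸ hv)⟩ a), ?_⟩
      rw [columns_mulVec]
      have := congrArg Subtype.val
        ((b d).basis.sum_repr ⟨v, (mem_lowest_iff h (hw0 d)).2 (hdi ▸ hv)⟩)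
      rw [Submodule.coe_sum] at this
      exact this.symm
    gram_eq := fun d => by
      ext1 i j
      rw [conjTranspose_columns_mul, ← (b d).gram_eq]
      rfl }

omit [DecidableEq n] in
theorem star_dotProduct_mulVec (A : Matrix n n ℍ[ℝ]) (v u : n → ℍ[ℝ]) :
    star (star v ⬝ᵥ (A *ᵥ u)) = star u ⬝ᵥ (Aᴴ *ᵥ v) := by
  rw [← Matrix.star_dotProduct_star, star_star, Matrix.star_mulVec, Matrix.dotProduct_mulVec]

/-- Each of the `d - 1` factors `X` changes sign when moved to the other argument. -/
theorem isEpsHermitian_inducedForm (hJ : Jᴴ = J) (hX : Xᴴ * J + J * X = 0) (d : ℕ)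
    (S : Submodule ℍ[ℝ]ᵐᵒᵖ (n → ℍ[ℝ])) :
    IsEpsHermitian ((-1) ^ (d - 1)) fun v u : S => inducedForm J X d v u where
  add_right v u w := by
    simp only [inducedForm, Submodule.coe_add, Matrix.mulVec_add, dotProduct_add]
  smul_right v u c := by
    simp only [inducedForm, Submodule.coe_smul, Matrix.mulVec_smul, dotProduct_smul]
    rfl
  star_eq v u := by
    have e := conjTranspose_pow_mul_mul hX (d - 1) (1 : Matrix n n ℍ[ℝ]) (1 : Matrix n n ℍ[ℝ])
    simp only [Matrix.mul_one, Matrix.conjTranspose_one, Matrix.one_mul] at e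
    rw [inducedForm, Matrix.mulVec_mulVec, star_dotProduct_mulVec, Matrix.conjTranspose_mul, hJ, e,
      Matrix.smul_mulVec, dotProduct_smul, ← Matrix.mulVec_mulVec]
    rfl
  eps := neg_one_pow_eq_or ℝ _

/-- By the orthogonality relations `X ^ (d - 1) u` pairs nontrivially at most with `L(d-1)` among
the spaces `X ^ l L(i)`. If it is orthogonal to that too, it lies in the radical of `J`, which
contradicts `pow_x_ne_zero` unless `u = 0`. -/
theorem eq_zero_of_inducedForm_eq_zero
    (h : Relations (mulVecEnd X) (mulVecEnd H) (mulVecEnd Y))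
    (skew_x : Xᴴ * J + J * X = 0) (skew_h : Hᴴ * J + J * H = 0) (hJ : IsUnit J) {d : ℕ}
    (hd : d ≠ 0) {u : n → ℍ[ℝ]} (hu : u ∈ lowest X H Y d)
    (h0 : ∀ v ∈ lowest X H Y d, inducedForm J X d v u = 0) : u = 0 := by
  by_contra hu0
  have hu' := (mem_lowest_iff h hd).1 hu
  refine h.pow_x_ne_zero hu' hu0 le_rfl ?_
  rw [mulVecEnd_pow_apply]
  set y := (X ^ (d - 1)) *ᵥ u with hy
  let S : Submodule ℝ (n → ℍ[ℝ]) :=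
    { carrier := {v | star v ⬝ᵥ (J *ᵥ y) = 0}
      zero_mem' := by simp
      add_mem' := fun {v w} hv hw => by
        rw [Set.mem_ofPred_eq] at hv hw ⊢
        rw [star_add, add_dotProduct, hv, hw, add_zero]
      smul_mem' := fun r v hv => by
        rw [Set.mem_ofPred_eq] at hv ⊢
        have e : star (r • v) = r • star v := funext fun i => Quaternion.star_smul r (v i)
        rw [e, smul_dotProduct, hv, smul_zero] }
  have hS : S = ⊤ := h.eq_top_of_forall_mem fun i l v hv => by
    have hv' : v ∈ lowest X H Y (i + 1) := (mem_lowest_iff h (Nat.succ_ne_zero i)).2 hv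
    change star _ ⬝ᵥ (J *ᵥ y) = 0
    rw [mulVecEnd_pow_apply]
    have e := congrFun (congrFun (conjTranspose_pow_mul_mul skew_x l
      (columns fun _ : Unit => v) (X ^ (d - 1) * columns fun _ : Unit => u)) ()) ()
    have e1 : (X ^ l * columns fun _ : Unit => v) = columns fun _ : Unit => (X ^ l) *ᵥ v := rfl
    rw [e1, conjTranspose_columns_mul] at e
    refine e.trans ?_
    by_cases hl : i = l + (d - 1) ∧ d - 1 = l + (d - 1)
    · obtain rfl : l = 0 := by omega
      obtain rfl : d = i + 1 := by omega
      rw [pow_zero, one_smul, pow_zero, Matrix.one_mul, conjTranspose_columns_mul]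
      exact h0 v hv'
    · rw [← Matrix.mul_assoc (X ^ l), ← pow_add,
        (lowestColumns_columns h (Nat.succ_ne_zero i) fun _ => hv').conjTranspose_mul_mul_eq_zero h
          skew_x skew_h (lowestColumns_columns h hd fun _ => hu) hl, smul_zero]
      rfl
  have hJy : J *ᵥ y = 0 := funext fun i => by
    have hi : (Pi.single i 1 : n → ℍ[ℝ]) ∈ S := hS ▸ Submodule.mem_top
    have hi' : star (Pi.single i 1 : n → ℍ[ℝ]) ⬝ᵥ (J *ᵥ y) = 0 := hi
    simpa using hi'
  obtain ⟨J, rfl⟩ := hJ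
  have := congrArg (fun z => J⁻¹.val *ᵥ z) hJy
  simpa using this

theorem exists_hasSignature
    (h : Relations (mulVecEnd X) (mulVecEnd H) (mulVecEnd Y)) (hJ' : Jᴴ = J)
    (skew_x : Xᴴ * J + J * X = 0) (skew_h : Hᴴ * J + J * H = 0) (hJ : IsUnit J) {d : ℕ}
    (hd : Odd d) : ∃ a b, HasSignature (inducedForm J X d) (lowest X H Y d) a b := by
  have hB := isEpsHermitian_inducedForm hJ' skew_x d (lowest X H Y d)
  have hev : Even (d - 1) := Nat.Odd.sub_odd hd odd_one
  rw [hev.neg_one_pow] at hB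
  obtain ⟨m, e, s, hs, he⟩ := hB.exists_basis
    (fun u hu => Subtype.ext (eq_zero_of_inducedForm_eq_zero h skew_x skew_h hJ hd.pos.ne' u.2
      fun v hv => hu ⟨v, hv⟩)) {1, -1} (by rintro s (rfl | rfl) <;> simp)
    (fun v hv => exists_star_mul_mul_eq_sign (by simpa using hB.star_eq v v) hv)
  classical
  -- Reorder the basis so that the vectors of value `1` come first.
  let f : Fin m ≃ Fin (Fintype.card {i // s i = 1}) ⊕ Fin (Fintype.card {i // ¬s i = 1}) :=
    (Equiv.sumCompl fun i => s i = 1).symm.trans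
      (Equiv.sumCongr (Fintype.equivFin _) (Fintype.equivFin _))
  refine ⟨_, _, e.reindex f, fun i j => ?_⟩
  rw [Module.Basis.reindex_apply, Module.Basis.reindex_apply]
  refine (he _ _).trans ?_
  have hsign : signMatrix (Fintype.card {i // s i = 1}) (Fintype.card {i // ¬s i = 1}) =
      Matrix.diagonal (s ∘ f.symm) := by
    rw [signMatrix, ← Matrix.diagonal_one, ← Matrix.diagonal_one, Matrix.diagonal_neg,
      Matrix.fromBlocks_diagonal]
    congr 1
    ext1 i
    rcases i with i | i
    · exact ((Fintype.equivFin {i // s i = 1}).symm i).2.symm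
    · have h1 := ((Fintype.equivFin {i // ¬s i = 1}).symm i).2
      exact ((hs _).resolve_left h1).symm
  rw [hsign]
  simp [Matrix.diagonal_apply]

theorem exists_basis_unitJ
    (h : Relations (mulVecEnd X) (mulVecEnd H) (mulVecEnd Y)) (hJ' : Jᴴ = J)
    (skew_x : Xᴴ * J + J * X = 0) (skew_h : Hᴴ * J + J * H = 0) (hJ : IsUnit J) {d : ℕ}
    (hd : Even d) (hd0 : d ≠ 0) :
    ∃ e : Module.Basis (Fin (mult X H Y d)) ℍ[ℝ]ᵐᵒᵖ (lowest X H Y d),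
      ∀ i j, inducedForm J X d (e i) (e j) = Matrix.diagonal (fun _ => unitJ) i j := by
  have hB := isEpsHermitian_inducedForm hJ' skew_x d (lowest X H Y d)
  have hodd : Odd (d - 1) := Nat.Even.sub_odd (Nat.one_le_iff_ne_zero.2 hd0) hd odd_one
  rw [hodd.neg_one_pow] at hB
  have hJ0 : unitJ ≠ 0 := fun h0 => by
    simpa [imJ_unitJ] using congrArg QuaternionAlgebra.imJ h0
  obtain ⟨m, e, s, hs, he⟩ := hB.exists_basis
    (fun u hu => Subtype.ext (eq_zero_of_inducedForm_eq_zero h skew_x skew_h hJ hd0 u.2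
      fun v hv => hu ⟨v, hv⟩)) {unitJ} (by rintro s rfl; exact hJ0)
    (fun v hv => exists_star_mul_mul_eq_unitJ (by simpa using hB.star_eq v v) hv)
  obtain rfl : m = mult X H Y d := by
    rw [mult, Module.finrank_eq_card_basis e, Fintype.card_fin]
  obtain rfl : s = fun _ => unitJ := funext hs
  exact ⟨e, he⟩

end

theorem signMatrix_conjTranspose (p q : ℕ) : (signMatrix p q)ᴴ = signMatrix p q := by
  simp [signMatrix, Matrix.fromBlocks_conjTranspose]

theorem signMatrix_mul_self (p q : ℕ) : signMatrix p q * signMatrix p q = 1 := by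
  simp [signMatrix, Matrix.fromBlocks_multiply]

/-- The matrix `signMatrix p q` as a unit. -/
noncomputable def signUnit (p q : ℕ) : (Matrix (Fin p ⊕ Fin q) (Fin p ⊕ Fin q) ℍ[ℝ])ˣ :=
  ⟨signMatrix p q, signMatrix p q, signMatrix_mul_self p q, signMatrix_mul_self p q⟩

/-- The diagonal matrix with entries `j` as a unit. -/
noncomputable def diagonalUnitJ (m : ℕ) : (Matrix (Fin m) (Fin m) ℍ[ℝ])ˣ where
  val := Matrix.diagonal fun _ => unitJ
  inv := Matrix.diagonal fun _ => -unitJ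
  val_inv := by simp [unitJ_mul_unitJ]
  inv_val := by simp [unitJ_mul_unitJ]

theorem relations_of_isSl2Triple {p q : ℕ} {X H Y : sp p q} (h : IsSl2Triple H X Y) :
    Relations (mulVecEnd X.1) (mulVecEnd H.1) (mulVecEnd Y.1) where
  xy := by
    have e : X.1 * Y.1 - Y.1 * X.1 = H.1 := congrArg Subtype.val h.lie_e_f
    rw [← map_mul, ← map_mul, ← map_add, ← e, add_sub_cancel]
  hx := by
    have e : H.1 * X.1 - X.1 * H.1 = (2 • X : sp p q).1 := congrArg Subtype.val h.lie_h_e_nsmul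
    have e' : (2 • X : sp p q).1 = (2 : ℝ) • X.1 := by
      rw [← Nat.cast_smul_eq_nsmul ℝ]
      rfl
    rw [← map_mul, ← map_mul, ← map_smul, ← map_add, ← e', ← e, add_sub_cancel]
  hy := by
    have e : H.1 * Y.1 - Y.1 * H.1 = (-(2 • Y) : sp p q).1 :=
      congrArg Subtype.val h.lie_h_f_nsmul
    have e' : (-(2 • Y) : sp p q).1 = -((2 : ℝ) • Y.1) := by
      rw [← Nat.cast_smul_eq_nsmul ℝ]
      rfl
    rw [← map_mul, ← map_mul, ← map_smul, ← map_sub, sub_eq_add_neg, ← e', ← e, add_sub_cancel]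

/-- Splitting a product over a sum type, as topological groups. -/
def sumPiContinuousMulEquiv {A B : Type} (G : A ⊕ B → Type) [∀ d, Group (G d)]
    [∀ d, TopologicalSpace (G d)] :
    (∀ d, G d) ≃ₜ* (∀ a, G (Sum.inl a)) × (∀ b, G (Sum.inr b)) :=
  { Homeomorph.sumPiEquivProdPi A B G with
    map_mul' := fun _ _ => rfl }

section

variable {n : Type} [Fintype n] [DecidableEq n] {J X H Y : Matrix n n ℍ[ℝ]}

/-- Two families of Gram bases as one family over the sum of the index types. -/
def GramBasis.sumRec {A B : Type} {w : A ⊕ B → ℕ}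
    (bA : ∀ a, GramBasis J X H Y (w (Sum.inl a))) (bB : ∀ b, GramBasis J X H Y (w (Sum.inr b))) :
    ∀ d, GramBasis J X H Y (w d)
  | Sum.inl a => bA a
  | Sum.inr b => bB b

theorem nonempty_centralizerEquiv_prod
    (h : Relations (mulVecEnd X) (mulVecEnd H) (mulVecEnd Y))
    (skew_x : Xᴴ * J + J * X = 0) (skew_h : Hᴴ * J + J * H = 0) (hJ : IsUnit J)
    {A B : Type} [Finite A] [Finite B] {w : A ⊕ B → ℕ} (hw : Function.Injective w)
    (hdims : Set.range w = dims X H Y)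
    (bA : ∀ a, GramBasis J X H Y (w (Sum.inl a))) (bB : ∀ b, GramBasis J X H Y (w (Sum.inr b))) :
    Nonempty (adCentralizer (formGroup J) {X, H, Y} ≃ₜ*
      (∀ a, formGroup (bA a).gram.val) × (∀ b, formGroup (bB b).gram.val)) := by
  have : Fintype (A ⊕ B) := Fintype.ofFinite _
  -- `GramBasis.sumRec` reduces by definition on each summand, so both factors have the required
  -- form.
  exact ⟨(LowestFrame.ofBases h skew_x skew_h hJ hw hdims
    (GramBasis.sumRec bA bB)).centralizerEquiv.trans
    (sumPiContinuousMulEquiv fun d => formGroup (GramBasis.sumRec bA bB d).gram.val)⟩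

end

end QuatForm

/-! ### The structure of the centralizer -/

theorem mainTheorem11 (p q : ℕ) (X H Y : QuatForm.sp p q)
    (hX0 : X ≠ 0)
    (hX : IsNilpotent (LieAlgebra.ad ℝ (QuatForm.sp p q) X))
    (hXHY : IsSl2Triple H X Y) :
    (∀ θ ∈ QuatForm.dims X.1 H.1 Y.1, Odd θ →
      ∃ a b : ℕ, QuatForm.HasSignature
        (QuatForm.inducedForm (QuatForm.signMatrix p q) X.1 θ)
        (QuatForm.lowest X.1 H.1 Y.1 θ) a b) ∧
    ∀ P Q : ℕ → ℕ,
      (∀ θ ∈ QuatForm.dims X.1 H.1 Y.1, Odd θ →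
        QuatForm.HasSignature
          (QuatForm.inducedForm (QuatForm.signMatrix p q) X.1 θ)
          (QuatForm.lowest X.1 H.1 Y.1 θ) (P θ) (Q θ)) →
      Nonempty
        (QuatForm.adCentralizer (QuatForm.Sp p q) {X.1, H.1, Y.1} ≃ₜ*
          ((η : {d : ℕ // d ∈ QuatForm.dims X.1 H.1 Y.1 ∧ Even d}) →
            QuatForm.SOStar (QuatForm.mult X.1 H.1 Y.1 η.1)) ×
          ((θ : {d : ℕ // d ∈ QuatForm.dims X.1 H.1 Y.1 ∧ Odd d}) →
            QuatForm.Sp (P θ.1) (Q θ.1))) := by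
  have rel := QuatForm.relations_of_isSl2Triple hXHY
  have hJ := (QuatForm.signUnit p q).isUnit
  have hJ' := QuatForm.signMatrix_conjTranspose p q
  refine ⟨fun θ _ hodd => QuatForm.exists_hasSignature rel hJ' X.2.2 H.2.2 hJ hodd,
    fun P Q hPQ => ?_⟩
  let A := {d : ℕ // d ∈ QuatForm.dims X.1 H.1 Y.1 ∧ Even d}
  let B := {d : ℕ // d ∈ QuatForm.dims X.1 H.1 Y.1 ∧ Odd d}
  have : Finite A := (QuatForm.finite_dims.subset fun d (hd : _ ∧ Even d) => hd.1).to_subtype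
  have : Finite B := (QuatForm.finite_dims.subset fun d (hd : _ ∧ Odd d) => hd.1).to_subtype
  let w : A ⊕ B → ℕ := Sum.elim Subtype.val Subtype.val
  have hw : Function.Injective w := by
    rintro (a | a) (b | b) (hab : a.1 = b.1)
    · rw [Subtype.ext hab]
    · exact absurd b.2.2 (Nat.not_odd_iff_even.2 (hab ▸ a.2.2))
    · exact absurd a.2.2 (Nat.not_odd_iff_even.2 (hab ▸ b.2.2))
    · rw [Subtype.ext hab]
  have hdims : Set.range w = QuatForm.dims X.1 H.1 Y.1 := by
    ext d
    constructor
    · rintro ⟨a | a, rfl⟩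
      exacts [a.2.1, a.2.1]
    · intro hd
      rcases Nat.even_or_odd d with h | h
      exacts [⟨Sum.inl ⟨d, hd, h⟩, rfl⟩, ⟨Sum.inr ⟨d, hd, h⟩, rfl⟩]
  -- Zero is even, so it has to be ruled out as a dimension before `d - 1` can be called odd.
  have hA0 : ∀ a : A, a.1 ≠ 0 := fun a => by
    obtain ⟨k, hk, -⟩ := (QuatForm.mem_dims_iff rel).1 a.2.1
    omega
  choose eA heA using fun a : A =>
    QuatForm.exists_basis_unitJ rel hJ' X.2.2 H.2.2 hJ a.2.2 (hA0 a)
  choose eB heB using fun b : B => hPQ b.1 b.2.1 b.2.2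
  exact QuatForm.nonempty_centralizerEquiv_prod rel X.2.2 H.2.2 hJ hw hdims
    (fun a => ⟨_, inferInstance, inferInstance, eA a, QuatForm.diagonalUnitJ _, heA a⟩)
    (fun b => ⟨_, inferInstance, inferInstance, eB b, QuatForm.signUnit _ _, heB b⟩)
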